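/- Let $\mathcal P_d$ be the set of real symmetric positive definite $d\times d$ matrices with the affine-invariant Riemannian metric $\langle U,V\rangle_P=\operatorname{tr}(P^{-1}UP^{-1}V)$, its distance $\delta(P,Q)=\|\log(P^{-1/2}QP^{-1/2})\|_F$, and its Riemannian volume. For $\bar X\in\mathcal P_d$ and $\sigma>0$ let $G(\bar X,\sigma^2)$ be the distribution on $\mathcal P_d$ with density $$p_{\bar X,\sigma}(X)=\frac1{\zeta(\sigma)}\exp\Big(-\frac{\delta(X,\bar X)^2}{2\sigma^2}\Big)$$ with respect to the Riemannian volume, where $\zeta(\sigma)=\int_{\mathcal P_d}\exp\big(-\delta(X,I_d)^2/(2\sigma^2)\big)\,d\mathrm{vol}(X)$. Let $\bar X^1,\dots,\bar X^K\in\mathcal P_d$ and $\sigma>0$ and, for each class $k$, let $X^k_1,X^k_2,\dots$ be independent random matrices with distribution $\alpha_k=G(\bar X^k,\sigma^2)$. For training sizes $N=(N_1,\dots,N_K)$ let $\hat X^k_N$ be the Riemannian mean of $X^k_1,\dots,X^k_{N_k}$, i.e. the minimizer over $Y\in\mathcal P_d$ of $\sum_{i\le N_k}\delta(X^k_i,Y)^2$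 (an arbitrary point if $N_k=0$). The Minimum Distance to Mean (MDM) classifier $c_N$ assigns $Z\in\mathcal P_d$ to a class $k$ minimizing $\delta(Z,\hat X^k_N)$; a Bayes classifier $b$ assigns $Z$ to a class $k$ maximizing the likelihood $p_{\bar X^k,\sigma}(Z)$. Ties may be broken arbitrarily in both. Then the MDM classifier converges to the Bayes classifier as the numbers of training data tend to infinity. Precisely, almost surely, for every choice of MDM classifiers $(c_N)_N$: 1. for every $Z\in\mathcal P_d$, the class $c_N(Z)$ maximizes the likelihood of $Z$ as soon as all of $N_1,\dots,N_K$ are large enough (depending on $Z$); 2. if $\bar X^1,\dots,\bar X^K$ are pairwise distinct, then for every Bayes classifier $b$ and for almost every $Z\in\mathcal P_d$ with respect to the Riemannian volume, $c_N(Z)=b(Z)$ as soon as all of $N_1,\dots,N_K$ are large enough (depending on $Z$). -/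

import Mathlib

open MeasureTheory ProbabilityTheory Filter Topology

noncomputable section

/-- The set `P_d` of real symmetric positive definite `d × d` matrices. -/
def SPD (d : ℕ) : Type :=
  {A : Matrix (Fin d) (Fin d) ℝ // A.PosDef}

namespace SPD

variable {d K : ℕ}

/-- The underlying matrix. -/
def toMatrix (P : SPD d) : Matrix (Fin d) (Fin d) ℝ := P.1

/-- The topology induced from the space of matrices. -/
instance : TopologicalSpace (SPD d) :=
  TopologicalSpace.induced toMatrix inferInstance

/-- The Borel sigma-algebra. -/
instance : MeasurableSpace (SPD d) := borel (SPD d)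

instance : BorelSpace (SPD d) := ⟨rfl⟩

/-- The identity matrix as a point of `P_d`. -/
instance : One (SPD d) := ⟨⟨1, Matrix.PosDef.one⟩⟩

instance : Nonempty (SPD d) := ⟨1⟩

/-- `P ^ (-1/2)`, through the functional calculus of symmetric matrices. -/
def invSqrt (P : SPD d) : Matrix (Fin d) (Fin d) ℝ :=
  cfc (fun x : ℝ => (√x)⁻¹) P.toMatrix

/-- The Frobenius norm of a real matrix. -/
def frobenius (A : Matrix (Fin d) (Fin d) ℝ) : ℝ :=
  √(∑ i, ∑ j, A i j ^ 2)

/-- The affine-invariant distance `δ(P,Q) = ‖log (P^(-1/2) Q P^(-1/2))‖_F`. -/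
def dist (P Q : SPD d) : ℝ :=
  frobenius (cfc Real.log (P.invSqrt * Q.toMatrix * P.invSqrt))

/-- The affine-invariant Riemannian metric `⟨U,V⟩_P = tr (P⁻¹ U P⁻¹ V)`. -/
def metric (P : SPD d) (U V : Matrix (Fin d) (Fin d) ℝ) : ℝ :=
  (P.toMatrix⁻¹ * U * P.toMatrix⁻¹ * V).trace

/-- Index set of the entries of a matrix on and above the diagonal. -/
abbrev UpperIndex (d : ℕ) : Type := {p : Fin d × Fin d // p.1 ≤ p.2}

/-- The global chart of `P_d` given by the entries on and above the diagonal. -/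
def coords (P : SPD d) : UpperIndex d → ℝ :=
  fun p => P.toMatrix p.1.1 p.1.2

/-- The coordinate vector field of the chart `coords` in direction `p`: the symmetric matrix with
entry `1` at `p` and at the transposed position, and `0` elsewhere. -/
def coordVector (p : UpperIndex d) : Matrix (Fin d) (Fin d) ℝ :=
  Matrix.of fun i j => if (i, j) = p.1 ∨ (j, i) = p.1 then 1 else 0

/-- The matrix `g_P` of the Riemannian metric at `P` in the chart `coords`. -/
def gram (P : SPD d) : Matrix (UpperIndex d) (UpperIndex d) ℝ :=
  Matrix.of fun p q => metric P (coordVector p) (coordVector q)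

/-- The Riemannian volume `√(det g) dx` of the affine-invariant metric, where `dx` is Lebesgue
measure in the chart `coords`. -/
def riemannianVolume (d : ℕ) : Measure (SPD d) :=
  (Measure.comap coords (volume : Measure (UpperIndex d → ℝ))).withDensity
    fun P => ENNReal.ofReal √(gram P).det

/-- The normalization constant `ζ(σ)` of the isotropic Gaussian, computed at the center `I_d`. -/
def zeta (d : ℕ) (σ : ℝ) : ℝ :=
  ∫ P : SPD d, Real.exp (-(dist P 1) ^ 2 / (2 * σ ^ 2)) ∂(riemannianVolume d)

/-- The density of the isotropic Gaussian `G(M, σ²)` with respect to the Riemannian volume. -/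
def gaussianDensity (M : SPD d) (σ : ℝ) (P : SPD d) : ℝ :=
  1 / zeta d σ * Real.exp (-(dist P M) ^ 2 / (2 * σ ^ 2))

/-- The isotropic Riemannian Gaussian distribution `G(M, σ²)`. -/
def gaussian (M : SPD d) (σ : ℝ) : Measure (SPD d) :=
  (riemannianVolume d).withDensity fun P => ENNReal.ofReal (gaussianDensity M σ P)

/-- `M` is a Riemannian (Fréchet) mean of the sample `x`. -/
def IsRiemannianMean {N : ℕ} (x : Fin N → SPD d) (M : SPD d) : Prop :=
  ∀ Y : SPD d, ∑ i, dist (x i) M ^ 2 ≤ ∑ i, dist (x i) Y ^ 2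

/-- The Riemannian mean `argmin_Y ∑ i, δ(x_i, Y)²` of a sample
(an arbitrary point if the sample is empty). -/
def riemannianMean {N : ℕ} (x : Fin N → SPD d) : SPD d :=
  Classical.epsilon (IsRiemannianMean x)

/-- Class `k` maximizes the likelihood of `Z`, where `p l` is the likelihood function of
class `l`. -/
def IsBayesClass (p : Fin K → SPD d → ℝ) (Z : SPD d) (k : Fin K) : Prop :=
  ∀ l, p l Z ≤ p k Z

/-- A Bayes classifier assigns each `Z` to a class that maximizes the likelihood of `Z`. -/
def IsBayesClassifier (p : Fin K → SPD d → ℝ) (b : SPD d → Fin K) : Prop :=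
  ∀ Z, IsBayesClass p Z (b Z)

/-- A Minimum Distance to Mean classifier trained on `N k` matrices `x k` of each class `k`
assigns each `Z` to a class whose Riemannian mean is nearest to `Z`. -/
def IsMDMClassifier {N : Fin K → ℕ} (x : (k : Fin K) → Fin (N k) → SPD d)
    (c : SPD d → Fin K) : Prop :=
  ∀ Z l, dist Z (riemannianMean (x (c Z))) ≤ dist Z (riemannianMean (x l))

end SPD

end

/-! All classes share σ, so the likelihood of Z under class k strictly decreases in δ(Z, X̄^k), and
a Bayes class is one with a nearest center. If the sample means converge almost surely to the
centers (`ae_tendsto_riemannianMean`), every strict inequality between distances to centers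
eventually holds for the means, which gives part 1. For part 2, the maximizer is unique off the
bisectors, which are null (`riemannianVolume_bisector`).

Consistency is Wald's argument. For Y ≠ M the excess δ(x,Y)² - δ(x,M)² has positive expectation
under G(M,σ²) (`integral_excess_pos`): the volume is invariant under congruence, so all centers have
the same normalization and exp(-excess/2σ²) is a likelihood ratio with mean 1. The inequality e^(-u)
≥ 1 - u then gives a nonnegative expectation, and equality would put all mass on a bisector. The
strong law, applied to infima of the excess over small compact neighborhoods and combined with a
growth bound far away, makes positivity uniform off any neighborhood of M. Neither geodesic
convexity nor uniqueness of the sample mean enters.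

Bisectors are null because the differential of δ(·,M)² at Z determines M (`eq_of_gradDistSq_eq`). At
each point of the bisector some coordinate derivative of the difference of squared distances is
nonzero; along lines in that direction such points are isolated, hence countable, and Fubini
concludes.

Two devices support the analysis. Writing tr(f(A)g(B)) as a weighted sum over pairs of eigenvalues
(`exists_weights`) turns scalar estimates into matrix estimates. Comparing quadratic forms gives a
triangle inequality up to a factor √d, which suffices throughout. -/

/-! ### Trace estimates for functions of two symmetric matrices -/

section SpectralWeights

namespace Matrix

lemma IsHermitian.sum_sq_eq_trace {n : Type*} [Fintype n] {A : Matrix n n ℝ}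
    (hA : A.IsHermitian) :
    ∑ i, ∑ j, A i j ^ 2 = (A * A).trace := by
  simp only [trace, diag, mul_apply, sq]
  refine Finset.sum_congr rfl fun i _ => Finset.sum_congr rfl fun j _ => ?_
  rw [show A j i = A i j from by simpa using hA.apply i j]

variable {n : Type*} [Fintype n] [DecidableEq n] {A B : Matrix n n ℝ}

lemma continuousOn_spectrum_real (f : ℝ → ℝ) (A : Matrix n n ℝ) :
    ContinuousOn f (spectrum ℝ A) :=
  (finite_real_spectrum (A := A)).continuousOn f

lemma isHermitian_cfc (f : ℝ → ℝ) (A : Matrix n n ℝ) : (cfc f A).IsHermitian :=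
  cfc_predicate f A

lemma IsHermitian.trace_cfc (hA : A.IsHermitian) (f : ℝ → ℝ) :
    (cfc f A).trace = ∑ i, f (hA.eigenvalues i) := by
  rw [hA.cfc_eq, IsHermitian.cfc, Unitary.conjStarAlgAut_apply, trace_mul_comm, ← mul_assoc]
  simp [trace_diagonal]

/-- The traces `tr (f(A) g(B))` are sums over pairs of eigenvalues, with weights given by the
squared inner products of the eigenvectors. -/
lemma IsHermitian.exists_weights (hA : A.IsHermitian) (hB : B.IsHermitian) :
    ∃ w : n → n → ℝ, (∀ i j, 0 ≤ w i j) ∧ (∀ j, ∑ i, w i j = 1) ∧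
      ∀ f g : ℝ → ℝ, (cfc f A * cfc g B).trace =
        ∑ i, ∑ j, w i j * (f (hA.eigenvalues i) * g (hB.eigenvalues j)) := by
  set U : Matrix n n ℝ := hA.eigenvectorUnitary.1 with hU
  set V : Matrix n n ℝ := hB.eigenvectorUnitary.1 with hV
  have hUU : U * star U = 1 := Unitary.mul_star_self_of_mem hA.eigenvectorUnitary.2
  have hVV : star V * V = 1 := Unitary.star_mul_self_of_mem hB.eigenvectorUnitary.2
  -- `star U * V` is orthogonal, so the squares of its entries sum to one along each column.
  refine ⟨fun i j => (star U * V) i j ^ 2, fun i j => sq_nonneg _, fun j => ?_, fun f g => ?_⟩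
  · have h : star (star U * V) * (star U * V) = 1 := by
      rw [star_mul, star_star, mul_assoc, ← mul_assoc U, hUU, one_mul, hVV]
    have h2 := congrFun (congrFun h j) j
    simpa [mul_apply, star_eq_conjTranspose, sq, mul_comm] using h2
  · have e1 : cfc f A = U * diagonal (f ∘ hA.eigenvalues) * star U := by
      rw [hA.cfc_eq, IsHermitian.cfc, Unitary.conjStarAlgAut_apply]; rfl
    have e2 : cfc g B = V * diagonal (g ∘ hB.eigenvalues) * star V := by
      rw [hB.cfc_eq, IsHermitian.cfc, Unitary.conjStarAlgAut_apply]; rfl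
    have e3 : (cfc f A * cfc g B).trace = (diagonal (f ∘ hA.eigenvalues) * (star U * V) *
        (diagonal (g ∘ hB.eigenvalues) * star (star U * V))).trace := by
      rw [e1, e2, star_mul, star_star]
      calc _ = (U * (diagonal (f ∘ hA.eigenvalues) * (star U * V) *
        (diagonal (g ∘ hB.eigenvalues) * star V))).trace := by simp only [mul_assoc]
        _ = _ := by rw [trace_mul_comm]; simp only [mul_assoc]
    rw [e3]
    simp only [trace, diag]
    refine Finset.sum_congr rfl fun i _ => ?_
    rw [mul_apply]
    refine Finset.sum_congr rfl fun j _ => ?_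
    rw [diagonal_mul, diagonal_mul]
    simp only [star_apply, Function.comp, star_trivial]
    ring

/-- The squared Frobenius distance of `f(A)` and `g(B)` in terms of pairs of eigenvalues. -/
lemma sum_sq_cfc_sub_cfc (hA : A.IsHermitian) (hB : B.IsHermitian) {w : n → n → ℝ}
    (hw : ∀ f g : ℝ → ℝ, (cfc f A * cfc g B).trace =
        ∑ i, ∑ j, w i j * (f (hA.eigenvalues i) * g (hB.eigenvalues j))) (f g : ℝ → ℝ) :
    ∑ i, ∑ j, (cfc f A - cfc g B) i j ^ 2 =
      ∑ i, ∑ j, w i j * (f (hA.eigenvalues i) - g (hB.eigenvalues j)) ^ 2 := by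
  rw [((isHermitian_cfc f A).sub (isHermitian_cfc g B)).sum_sq_eq_trace]
  have hA' : IsSelfAdjoint A := hA
  have hB' : IsSelfAdjoint B := hB
  -- Inserting the constant function 1 of the other matrix brings the pure terms into the two-matrix
  -- form covered by the weights.
  have h1 : cfc f A * cfc f A = cfc (fun x => f x * f x) A * cfc (fun _ : ℝ => (1 : ℝ)) B := by
    rw [cfc_const_one ℝ B, mul_one, cfc_mul f f A (continuousOn_spectrum_real _ _)
      (continuousOn_spectrum_real _ _)]
  have h2 : cfc g B * cfc g B = cfc (fun _ : ℝ => (1 : ℝ)) A * cfc (fun x => g x * g x) B := by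
    rw [cfc_const_one ℝ A, one_mul, cfc_mul g g B (continuousOn_spectrum_real _ _)
      (continuousOn_spectrum_real _ _)]
  rw [sub_mul, mul_sub, mul_sub, trace_sub, trace_sub, trace_sub, trace_mul_comm (cfc g B) (cfc f A),
    h1, h2, hw, hw, hw]
  simp only [← Finset.sum_sub_distrib]
  refine Finset.sum_congr rfl fun i _ => Finset.sum_congr rfl fun j _ => ?_
  ring

lemma sum_sq_sub (hA : A.IsHermitian) (hB : B.IsHermitian) {w : n → n → ℝ}
    (hw : ∀ f g : ℝ → ℝ, (cfc f A * cfc g B).trace =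
        ∑ i, ∑ j, w i j * (f (hA.eigenvalues i) * g (hB.eigenvalues j))) :
    ∑ i, ∑ j, (A - B) i j ^ 2 =
      ∑ i, ∑ j, w i j * (hA.eigenvalues i - hB.eigenvalues j) ^ 2 := by
  have := sum_sq_cfc_sub_cfc hA hB hw (fun x => x) (fun x => x)
  have hA' : IsSelfAdjoint A := hA
  have hB' : IsSelfAdjoint B := hB
  rwa [cfc_id' ℝ A, cfc_id' ℝ B] at this

/-- Eigenvalues depend continuously on the matrix: a uniform lower bound persists nearby. -/
lemma IsHermitian.le_eigenvalues_of_sum_sq_lt (hA : A.IsHermitian) (hB : B.IsHermitian) {m ε : ℝ}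
    (hm : ∀ i, m ≤ hA.eigenvalues i) (hε : 0 ≤ ε) (h : ∑ i, ∑ j, (A - B) i j ^ 2 < ε ^ 2) (j : n) :
    m - ε ≤ hB.eigenvalues j := by
  obtain ⟨w, hw0, hw1, hw⟩ := hA.exists_weights hB
  by_contra! hlt
  rw [sum_sq_sub hA hB hw] at h
  -- An eigenvalue of `B` below `m - ε` is at distance more than `ε` from every eigenvalue of `A`;
  -- its column of weights, of total mass one, already contributes `ε ^ 2`.
  refine absurd h (not_lt.2 ?_)
  calc ε ^ 2 = ∑ i, w i j * ε ^ 2 := by rw [← Finset.sum_mul, hw1, one_mul]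
    _ ≤ ∑ i, w i j * (hA.eigenvalues i - hB.eigenvalues j) ^ 2 := by
        refine Finset.sum_le_sum fun i _ => mul_le_mul_of_nonneg_left ?_ (hw0 i j)
        have := hm i
        exact pow_le_pow_left₀ hε (by linarith) 2
    _ ≤ _ := by
        refine Finset.sum_le_sum fun i _ => ?_
        exact Finset.single_le_sum (f := fun j => w i j * (hA.eigenvalues i - hB.eigenvalues j) ^ 2)
          (fun j _ => mul_nonneg (hw0 i j) (sq_nonneg _)) (Finset.mem_univ j)

/-- With nonnegative weights the scalar Lipschitz bound can be applied term by term, so the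
Frobenius norm inherits the same constant. -/
lemma sum_sq_cfc_sub_cfc_le (hA : A.IsHermitian) (hB : B.IsHermitian) {m L : ℝ} {f : ℝ → ℝ}
    (hf : ∀ a b, m ≤ a → m ≤ b → |f a - f b| ≤ L * |a - b|)
    (hmA : ∀ i, m ≤ hA.eigenvalues i) (hmB : ∀ i, m ≤ hB.eigenvalues i) :
    ∑ i, ∑ j, (cfc f A - cfc f B) i j ^ 2 ≤ L ^ 2 * ∑ i, ∑ j, (A - B) i j ^ 2 := by
  obtain ⟨w, hw0, hw1, hw⟩ := hA.exists_weights hB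
  rw [sum_sq_cfc_sub_cfc hA hB hw, sum_sq_sub hA hB hw, Finset.mul_sum]
  refine Finset.sum_le_sum fun i _ => ?_
  rw [Finset.mul_sum]
  refine Finset.sum_le_sum fun j _ => ?_
  have h1 := hf _ _ (hmA i) (hmB j)
  have h2 : (f (hA.eigenvalues i) - f (hB.eigenvalues j)) ^ 2 ≤
      L ^ 2 * (hA.eigenvalues i - hB.eigenvalues j) ^ 2 := by
    rw [← sq_abs, ← sq_abs (hA.eigenvalues i - _), ← mul_pow]
    exact pow_le_pow_left₀ (abs_nonneg _) h1 2
  calc _ ≤ w i j * (L ^ 2 * (hA.eigenvalues i - hB.eigenvalues j) ^ 2) :=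
        mul_le_mul_of_nonneg_left h2 (hw0 i j)
    _ = _ := by ring

/-- First order Taylor expansion of the trace function `tr φ`. -/
lemma abs_trace_cfc_sub_le (hA : A.IsHermitian) (hB : B.IsHermitian) {m C : ℝ} {φ ψ : ℝ → ℝ}
    (hφ : ∀ i, ∀ b, m ≤ b → |φ b - φ (hA.eigenvalues i) -
      ψ (hA.eigenvalues i) * (b - hA.eigenvalues i)| ≤ C * (b - hA.eigenvalues i) ^ 2)
    (hmB : ∀ i, m ≤ hB.eigenvalues i) :
    |(cfc φ B).trace - (cfc φ A).trace - (cfc ψ A * (B - A)).trace| ≤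
      C * ∑ i, ∑ j, (A - B) i j ^ 2 := by
  obtain ⟨w, hw0, hw1, hw⟩ := hA.exists_weights hB
  have hA' : IsSelfAdjoint A := hA
  have hB' : IsSelfAdjoint B := hB
  have e1 : (cfc φ B).trace = ∑ i, ∑ j, w i j * (1 * φ (hB.eigenvalues j)) := by
    rw [← hw (fun _ => 1) φ, cfc_const_one ℝ A, one_mul]
  have e2 : (cfc φ A).trace = ∑ i, ∑ j, w i j * (φ (hA.eigenvalues i) * 1) := by
    rw [← hw φ (fun _ => 1), cfc_const_one ℝ B, mul_one]
  have e3 : (cfc ψ A * B).trace =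
      ∑ i, ∑ j, w i j * (ψ (hA.eigenvalues i) * hB.eigenvalues j) := by
    rw [← hw ψ (fun x => x), cfc_id' ℝ B]
  have e4 : (cfc ψ A * A).trace =
      ∑ i, ∑ j, w i j * ((ψ (hA.eigenvalues i) * hA.eigenvalues i) * 1) := by
    rw [← hw (fun x => ψ x * x) (fun _ => 1), cfc_const_one ℝ B, mul_one,
      cfc_mul ψ (fun x => x) A (continuousOn_spectrum_real _ _) (continuousOn_spectrum_real _ _),
      cfc_id' ℝ A]
  rw [mul_sub, trace_sub, e1, e2, e3, e4, sum_sq_sub hA hB hw, Finset.mul_sum]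
  simp only [← Finset.sum_sub_distrib]
  refine (Finset.abs_sum_le_sum_abs _ _).trans (Finset.sum_le_sum fun i _ => ?_)
  rw [Finset.mul_sum]
  refine (Finset.abs_sum_le_sum_abs _ _).trans (Finset.sum_le_sum fun j _ => ?_)
  have h := hφ i _ (hmB j)
  rw [show w i j * (1 * φ (hB.eigenvalues j)) - w i j * (φ (hA.eigenvalues i) * 1) -
      (w i j * (ψ (hA.eigenvalues i) * hB.eigenvalues j) -
        w i j * ((ψ (hA.eigenvalues i) * hA.eigenvalues i) * 1)) =
      w i j * (φ (hB.eigenvalues j) - φ (hA.eigenvalues i) -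
      ψ (hA.eigenvalues i) * (hB.eigenvalues j - hA.eigenvalues i)) by ring, abs_mul,
      abs_of_nonneg (hw0 i j)]
  calc _ ≤ w i j * (C * (hB.eigenvalues j - hA.eigenvalues i) ^ 2) :=
        mul_le_mul_of_nonneg_left h (hw0 i j)
    _ = _ := by ring

end Matrix

end SpectralWeights

/-! ### Symmetry and congruence invariance of the distance -/

section DistanceAlgebra

namespace Matrix

lemma PosDef.isUnit_det' {n : Type*} [Fintype n] [DecidableEq n] {A : Matrix n n ℝ}
    (hA : A.PosDef) : IsUnit A.det := hA.det_pos.ne'.isUnit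

lemma PosDef.spectrum_pos {n : Type*} [Fintype n] [DecidableEq n] {A : Matrix n n ℝ}
    (hA : A.PosDef) {x : ℝ} (hx : x ∈ spectrum ℝ A) : 0 < x := by
  rw [hA.1.spectrum_real_eq_range_eigenvalues] at hx
  obtain ⟨i, rfl⟩ := hx
  exact hA.eigenvalues_pos i

lemma PosDef.cfc_invSqrt_mul_mul {n : Type*} [Fintype n] [DecidableEq n] {A : Matrix n n ℝ}
    (hA : A.PosDef) :
    cfc (fun x : ℝ => (√x)⁻¹) A * A * cfc (fun x : ℝ => (√x)⁻¹) A = 1 := by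
  have hA' : IsSelfAdjoint A := hA.1
  conv_lhs => enter [1, 2]; rw [← cfc_id' ℝ A]
  rw [← cfc_mul _ _ A (continuousOn_spectrum_real _ _) (continuousOn_spectrum_real _ _),
    ← cfc_mul _ _ A (continuousOn_spectrum_real _ _) (continuousOn_spectrum_real _ _),
    ← cfc_const_one ℝ A]
  refine cfc_congr fun x hx => ?_
  have hx := hA.spectrum_pos hx
  have h2 := Real.mul_self_sqrt hx.le
  have h3 : √x ≠ 0 := (Real.sqrt_pos.2 hx).ne'
  field_simp
  linarith

lemma PosDef.cfc_invSqrt_mul_cfc_invSqrt {n : Type*} [Fintype n] [DecidableEq n]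
    {A : Matrix n n ℝ} (hA : A.PosDef) :
    cfc (fun x : ℝ => (√x)⁻¹) A * cfc (fun x : ℝ => (√x)⁻¹) A = cfc (fun x : ℝ => x⁻¹) A := by
  rw [← cfc_mul _ _ A (continuousOn_spectrum_real _ _) (continuousOn_spectrum_real _ _)]
  refine cfc_congr fun x hx => ?_
  have hx := hA.spectrum_pos hx
  rw [← mul_inv, Real.mul_self_sqrt hx.le]

lemma IsHermitian.trace_cfc_eq_roots {n : Type*} [Fintype n] [DecidableEq n] {A : Matrix n n ℝ}
    (hA : A.IsHermitian) (f : ℝ → ℝ) : (cfc f A).trace = (A.charpoly.roots.map f).sum := by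
  rw [hA.trace_cfc, hA.roots_charpoly_eq_eigenvalues, Multiset.map_map]
  rfl

end Matrix

namespace SPD

open Matrix

variable {d : ℕ}

lemma posDef (P : SPD d) : P.toMatrix.PosDef := P.2

lemma isUnit_det (P : SPD d) : IsUnit P.toMatrix.det := P.posDef.isUnit_det'

@[ext]
lemma ext_toMatrix {P Q : SPD d} (h : P.toMatrix = Q.toMatrix) : P = Q := Subtype.ext h

@[simp] lemma toMatrix_one : (1 : SPD d).toMatrix = 1 := rfl

/-- The congruence `P ↦ A P Aᵀ`. -/
def cong (A : Matrix (Fin d) (Fin d) ℝ) (hA : IsUnit A) (P : SPD d) : SPD d :=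
  ⟨A * P.toMatrix * Aᵀ, by
    have := (IsUnit.posDef_star_right_conjugate_iff hA).2 P.posDef
    rwa [star_eq_conjTranspose, conjTranspose_eq_transpose_of_trivial] at this⟩

lemma toMatrix_cong (A : Matrix (Fin d) (Fin d) ℝ) (hA : IsUnit A) (P : SPD d) :
    (cong A hA P).toMatrix = A * P.toMatrix * Aᵀ := rfl

/-- The inverse of a positive definite matrix. -/
noncomputable def inverse (P : SPD d) : SPD d := ⟨P.toMatrix⁻¹, P.posDef.inv⟩

lemma toMatrix_inverse (P : SPD d) : P.inverse.toMatrix = P.toMatrix⁻¹ := rfl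

lemma invSqrt_mul_mul_invSqrt (P : SPD d) : P.invSqrt * P.toMatrix * P.invSqrt = 1 :=
  P.posDef.cfc_invSqrt_mul_mul

lemma transpose_invSqrt (P : SPD d) : P.invSqrtᵀ = P.invSqrt := by
  have : P.invSqrt.IsHermitian := isHermitian_cfc _ _
  simpa using this.eq

lemma isUnit_invSqrt (P : SPD d) : IsUnit P.invSqrt :=
  IsUnit.of_mul_eq_one_right _ P.invSqrt_mul_mul_invSqrt

lemma cong_invSqrt_self (P : SPD d) : cong P.invSqrt P.isUnit_invSqrt P = 1 := by
  ext1
  rw [toMatrix_cong, transpose_invSqrt, invSqrt_mul_mul_invSqrt, toMatrix_one]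

lemma invSqrt_mul_invSqrt (P : SPD d) : P.invSqrt * P.invSqrt = P.toMatrix⁻¹ := by
  have h := P.invSqrt_mul_mul_invSqrt
  have h1 : P.invSqrt * (P.invSqrt * P.toMatrix) = 1 := mul_eq_one_comm.1 h
  exact (inv_eq_left_inv (by rw [mul_assoc, h1])).symm

lemma frobenius_sq (A : Matrix (Fin d) (Fin d) ℝ) : frobenius A ^ 2 = ∑ i, ∑ j, A i j ^ 2 :=
  Real.sq_sqrt (Finset.sum_nonneg fun _ _ => Finset.sum_nonneg fun _ _ => sq_nonneg _)

lemma dist_nonneg (P Q : SPD d) : 0 ≤ dist P Q := Real.sqrt_nonneg _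

lemma dist_sq_eq_trace_invSqrt (P Q : SPD d) :
    dist P Q ^ 2 =
      (cfc (fun x => Real.log x ^ 2) (P.invSqrt * Q.toMatrix * P.invSqrt)).trace := by
  rw [dist, frobenius_sq, (isHermitian_cfc _ _).sum_sq_eq_trace, ← cfc_mul _ _ _
    (continuousOn_spectrum_real _ _) (continuousOn_spectrum_real _ _)]
  simp only [sq]

/-- `P^(-1/2) Q P^(-1/2)` and `P⁻¹ Q` have the same characteristic polynomial. This removes the
square roots, which behave badly under congruence. -/
lemma dist_sq_eq_roots (P Q : SPD d) :
    dist P Q ^ 2 =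
      ((P.toMatrix⁻¹ * Q.toMatrix).charpoly.roots.map fun x => Real.log x ^ 2).sum := by
  have h : (P.invSqrt * Q.toMatrix * P.invSqrt).IsHermitian := by
    have := (cong P.invSqrt P.isUnit_invSqrt Q).posDef.1
    rwa [toMatrix_cong, transpose_invSqrt] at this
  rw [dist_sq_eq_trace_invSqrt, h.trace_cfc_eq_roots, charpoly_mul_comm, ← mul_assoc,
    invSqrt_mul_invSqrt]

/-- Congruence by `A` turns `Q P⁻¹` into its conjugate `A Q P⁻¹ A⁻¹`, which has the same
eigenvalues. -/
lemma dist_cong (A : Matrix (Fin d) (Fin d) ℝ) (hA : IsUnit A) (P Q : SPD d) :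
    dist (cong A hA P) (cong A hA Q) = dist P Q := by
  have hA' : IsUnit A.det := (isUnit_iff_isUnit_det A).1 hA
  rw [← sq_eq_sq₀ (dist_nonneg _ _) (dist_nonneg _ _), dist_sq_eq_roots, dist_sq_eq_roots,
    toMatrix_cong, toMatrix_cong, Matrix.mul_inv_rev, Matrix.mul_inv_rev]
  congr 3
  rw [charpoly_mul_comm]
  have : A * Q.toMatrix * Aᵀ * (Aᵀ⁻¹ * (P.toMatrix⁻¹ * A⁻¹)) =
      A * (Q.toMatrix * P.toMatrix⁻¹ * A⁻¹) := by
    have h : Aᵀ * Aᵀ⁻¹ = 1 := mul_nonsing_inv _ (by rwa [det_transpose])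
    calc _ = A * Q.toMatrix * (Aᵀ * Aᵀ⁻¹) * (P.toMatrix⁻¹ * A⁻¹) := by simp only [mul_assoc]
      _ = _ := by rw [h, mul_one]; simp only [mul_assoc]
  rw [this, charpoly_mul_comm, mul_assoc, nonsing_inv_mul _ hA', mul_one, charpoly_mul_comm]

/-- The distance to `P` computed by any congruence that sends `P` to the identity. -/
lemma dist_sq_eq_trace {A : Matrix (Fin d) (Fin d) ℝ} (hA : IsUnit A) {P : SPD d}
    (hP : cong A hA P = 1) (Q : SPD d) :
    dist P Q ^ 2 = (cfc (fun x => Real.log x ^ 2) (cong A hA Q).toMatrix).trace := by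
  rw [← dist_cong A hA, hP, dist_sq_eq_roots, (cong A hA Q).posDef.1.trace_cfc_eq_roots,
    toMatrix_one, inv_one, one_mul]

lemma dist_one_inverse (P : SPD d) : dist 1 P.inverse = dist P 1 := by
  rw [← sq_eq_sq₀ (dist_nonneg _ _) (dist_nonneg _ _), dist_sq_eq_roots, dist_sq_eq_roots,
    toMatrix_inverse, toMatrix_one, inv_one, one_mul, mul_one]

/-- Inverting the eigenvalues only changes the signs of their logarithms. -/
lemma dist_one_comm (P : SPD d) : dist P 1 = dist 1 P := by
  rw [← sq_eq_sq₀ (dist_nonneg _ _) (dist_nonneg _ _), dist_sq_eq_trace P.isUnit_invSqrt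
    P.cong_invSqrt_self, dist_sq_eq_roots, toMatrix_one, inv_one, one_mul,
    ← P.posDef.1.trace_cfc_eq_roots, toMatrix_cong, toMatrix_one, mul_one, transpose_invSqrt]
  have hP : IsSelfAdjoint P.toMatrix := P.posDef.1
  have e : P.invSqrt * P.invSqrt = cfc (fun x : ℝ => x⁻¹) P.toMatrix :=
    P.posDef.cfc_invSqrt_mul_cfc_invSqrt
  rw [e, ← cfc_comp' (fun x => Real.log x ^ 2) (fun x : ℝ => x⁻¹) P.toMatrix
    (((finite_real_spectrum (A := P.toMatrix)).image _).continuousOn _)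
    (continuousOn_spectrum_real _ _)]
  simp [Real.log_inv]

lemma dist_comm (P Q : SPD d) : dist P Q = dist Q P := by
  rw [← dist_cong P.invSqrt P.isUnit_invSqrt P, ← dist_cong P.invSqrt P.isUnit_invSqrt Q,
    cong_invSqrt_self, dist_one_comm]

end SPD

end DistanceAlgebra

/-! ### Weak triangle inequality, continuity and compact balls -/

section DistanceTopology

namespace Matrix

/-- The quadratic form of a real symmetric matrix in coordinates with respect to eigenvectors. -/
lemma IsHermitian.dotProduct_mulVec_eq {n : Type*} [Fintype n] [DecidableEq n]
    {A : Matrix n n ℝ} (hA : A.IsHermitian) (v : n → ℝ) :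
    ∃ x : n → ℝ, v ⬝ᵥ v = ∑ i, x i ^ 2 ∧ v ⬝ᵥ A *ᵥ v = ∑ i, hA.eigenvalues i * x i ^ 2 := by
  set U : Matrix n n ℝ := hA.eigenvectorUnitary.1 with hU
  have hUU : U * star U = 1 := Unitary.mul_star_self_of_mem hA.eigenvectorUnitary.2
  have e : A = U * diagonal hA.eigenvalues * star U := by
    conv_lhs => rw [hA.spectral_theorem, Unitary.conjStarAlgAut_apply]
    rfl
  have key : ∀ D : Matrix n n ℝ, v ⬝ᵥ (U * D * star U) *ᵥ v =
      (star U *ᵥ v) ⬝ᵥ D *ᵥ (star U *ᵥ v) := by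
    intro D
    rw [← mulVec_mulVec, ← mulVec_mulVec, dotProduct_mulVec, star_eq_conjTranspose,
      conjTranspose_eq_transpose_of_trivial, mulVec_transpose]
  refine ⟨star U *ᵥ v, ?_, ?_⟩
  · have := key 1
    rw [mul_one, hUU, one_mulVec, one_mulVec] at this
    rw [this]
    simp [dotProduct, sq]
  · conv_lhs => rw [e]
    rw [key]
    simp only [dotProduct, mulVec_diagonal]
    exact Finset.sum_congr rfl fun i _ => by ring

lemma IsHermitian.exists_dotProduct_mulVec_eq_eigenvalue {n : Type*} [Fintype n] [DecidableEq n]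
    {A : Matrix n n ℝ} (hA : A.IsHermitian) (i : n) :
    ∃ v : n → ℝ, v ⬝ᵥ v = 1 ∧ v ⬝ᵥ A *ᵥ v = hA.eigenvalues i := by
  have h1 : (hA.eigenvectorBasis i).ofLp ⬝ᵥ (hA.eigenvectorBasis i).ofLp = 1 := by
    have := hA.eigenvectorBasis.orthonormal.1 i
    rw [EuclideanSpace.norm_eq, Real.sqrt_eq_one] at this
    simpa [dotProduct, sq] using this
  refine ⟨(hA.eigenvectorBasis i).ofLp, h1, ?_⟩
  rw [hA.mulVec_eigenvectorBasis, dotProduct_smul, h1, smul_eq_mul, mul_one]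

/-- Nonnegativity at `e_i ± e_j` gives `2 |A i j| ≤ A i i + A j j ≤ 2 c`. -/
lemma abs_apply_le_of_quadraticForm {n : Type*} [Fintype n] [DecidableEq n]
    {A : Matrix n n ℝ} (hA : A.IsHermitian) {c : ℝ} (h0 : ∀ v, 0 ≤ v ⬝ᵥ A *ᵥ v)
    (h1 : ∀ v, v ⬝ᵥ A *ᵥ v ≤ c * (v ⬝ᵥ v)) (i j : n) : |A i j| ≤ c := by
  have hij : A j i = A i j := by simpa using hA.apply i j
  have hi := h1 (Pi.single i 1)
  have hj := h1 (Pi.single j 1)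
  have hp := h0 (Pi.single i 1 + Pi.single j 1)
  have hm := h0 (Pi.single i 1 - Pi.single j 1)
  simp only [mulVec_add, mulVec_sub, dotProduct_add, dotProduct_sub, add_dotProduct,
    sub_dotProduct, mulVec_single_one, single_dotProduct, col_apply, one_mul, Pi.single_eq_same,
    mul_one] at hi hj hp hm
  rw [abs_le]
  constructor <;> linarith

end Matrix

namespace SPD

open Matrix

variable {d : ℕ}

/-- The quadratic forms of `P` and `Q` are within a factor `exp t` of each other. -/
def Comparable (t : ℝ) (P Q : SPD d) : Prop :=
  ∀ v : Fin d → ℝ, v ⬝ᵥ P.toMatrix *ᵥ v ≤ Real.exp t * (v ⬝ᵥ Q.toMatrix *ᵥ v) ∧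
    v ⬝ᵥ Q.toMatrix *ᵥ v ≤ Real.exp t * (v ⬝ᵥ P.toMatrix *ᵥ v)

lemma Comparable.trans {s t : ℝ} {P Q R : SPD d} (h : Comparable s P Q) (h' : Comparable t Q R) :
    Comparable (s + t) P R := by
  intro v
  have e1 := Real.exp_pos s
  have e2 := Real.exp_pos t
  constructor
  · calc _ ≤ _ := (h v).1
      _ ≤ Real.exp s * (Real.exp t * _) := mul_le_mul_of_nonneg_left (h' v).1 e1.le
      _ = _ := by rw [Real.exp_add, mul_assoc]
  · calc _ ≤ _ := (h' v).2
      _ ≤ Real.exp t * (Real.exp s * _) := mul_le_mul_of_nonneg_left (h v).2 e2.le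
      _ = _ := by rw [Real.exp_add]; ring

lemma dotProduct_cong_mulVec (A : Matrix (Fin d) (Fin d) ℝ) (hA : IsUnit A) (P : SPD d)
    (v : Fin d → ℝ) :
    v ⬝ᵥ (cong A hA P).toMatrix *ᵥ v = (Aᵀ *ᵥ v) ⬝ᵥ P.toMatrix *ᵥ (Aᵀ *ᵥ v) := by
  rw [toMatrix_cong, ← mulVec_mulVec, ← mulVec_mulVec, dotProduct_mulVec, mulVec_transpose]

lemma comparable_cong_iff (A : Matrix (Fin d) (Fin d) ℝ) (hA : IsUnit A) {t : ℝ} {P Q : SPD d} :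
    Comparable t (cong A hA P) (cong A hA Q) ↔ Comparable t P Q := by
  constructor
  · intro h v
    have hA' : IsUnit Aᵀ.det := by rw [det_transpose]; exact (isUnit_iff_isUnit_det A).1 hA
    have := h (Aᵀ⁻¹ *ᵥ v)
    rwa [dotProduct_cong_mulVec, dotProduct_cong_mulVec, mulVec_mulVec, mul_nonsing_inv _ hA',
      one_mulVec] at this
  · intro h v
    simpa only [dotProduct_cong_mulVec] using h (Aᵀ *ᵥ v)

lemma dist_one_sq (P : SPD d) :
    dist 1 P ^ 2 = ∑ i, Real.log (P.posDef.1.eigenvalues i) ^ 2 := by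
  rw [dist_sq_eq_roots, toMatrix_one, inv_one, one_mul, ← P.posDef.1.trace_cfc_eq_roots,
    P.posDef.1.trace_cfc]

lemma abs_log_eigenvalues_le (P : SPD d) (i : Fin d) :
    |Real.log (P.posDef.1.eigenvalues i)| ≤ dist 1 P := by
  refine abs_le_of_sq_le_sq ?_ (dist_nonneg _ _)
  rw [dist_one_sq]
  exact Finset.single_le_sum (f := fun i => Real.log (P.posDef.1.eigenvalues i) ^ 2)
    (fun _ _ => sq_nonneg _) (Finset.mem_univ i)

lemma comparable_one (P : SPD d) : Comparable (dist 1 P) 1 P := by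
  intro v
  obtain ⟨x, h1, h2⟩ := P.posDef.1.dotProduct_mulVec_eq v
  rw [toMatrix_one, one_mulVec, h1, h2, Finset.mul_sum, Finset.mul_sum]
  have hl : ∀ i, P.posDef.1.eigenvalues i ≤ Real.exp (dist 1 P) := fun i => by
    rw [← Real.log_le_iff_le_exp (P.posDef.eigenvalues_pos i)]
    exact (le_abs_self _).trans (P.abs_log_eigenvalues_le i)
  have hr : ∀ i, 1 ≤ Real.exp (dist 1 P) * P.posDef.1.eigenvalues i := fun i => by
    have h := (neg_abs_le _).trans' (neg_le_neg (P.abs_log_eigenvalues_le i))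
    rw [Real.le_log_iff_exp_le (P.posDef.eigenvalues_pos i)] at h
    calc 1 = Real.exp (dist 1 P) * Real.exp (-dist 1 P) := by rw [← Real.exp_add]; simp
      _ ≤ _ := mul_le_mul_of_nonneg_left h (Real.exp_pos _).le
  constructor
  · refine Finset.sum_le_sum fun i _ => ?_
    rw [← mul_assoc]
    exact le_mul_of_one_le_left (sq_nonneg _) (hr i)
  · exact Finset.sum_le_sum fun i _ => mul_le_mul_of_nonneg_right (hl i) (sq_nonneg _)

lemma comparable_dist (P Q : SPD d) : Comparable (dist P Q) P Q := by
  rw [← comparable_cong_iff P.invSqrt P.isUnit_invSqrt,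
    ← dist_cong P.invSqrt P.isUnit_invSqrt, cong_invSqrt_self]
  exact comparable_one _

/-- Evaluating the forms at unit eigenvectors bounds every `|log λ_i|` by `t`; the factor `√d` comes
from summing `d` squares. -/
lemma Comparable.dist_one_le {t : ℝ} {P : SPD d} (h : Comparable t 1 P) (ht : 0 ≤ t) :
    dist 1 P ≤ √d * t := by
  rw [← sq_le_sq₀ (dist_nonneg _ _) (by positivity), mul_pow, Real.sq_sqrt (by positivity),
    dist_one_sq]
  have : ∀ i, Real.log (P.posDef.1.eigenvalues i) ^ 2 ≤ t ^ 2 := fun i => by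
    obtain ⟨v, h1, h2⟩ := P.posDef.1.exists_dotProduct_mulVec_eq_eigenvalue i
    have hv := h v
    have hp := P.posDef.eigenvalues_pos i
    rw [toMatrix_one, one_mulVec, h1, h2, mul_one] at hv
    refine sq_le_sq.2 ((abs_le.2 ⟨?_, ?_⟩).trans (le_abs_self t))
    · rw [Real.le_log_iff_exp_le hp, Real.exp_neg, inv_le_iff_one_le_mul₀' (Real.exp_pos _)]
      exact hv.1
    · rw [Real.log_le_iff_le_exp hp]
      exact hv.2
  calc _ ≤ ∑ _i : Fin d, t ^ 2 := Finset.sum_le_sum fun i _ => this i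
    _ = _ := by simp

lemma Comparable.dist_le {t : ℝ} {P Q : SPD d} (h : Comparable t P Q) (ht : 0 ≤ t) :
    dist P Q ≤ √d * t := by
  rw [← comparable_cong_iff P.invSqrt P.isUnit_invSqrt, cong_invSqrt_self] at h
  rw [← dist_cong P.invSqrt P.isUnit_invSqrt, cong_invSqrt_self]
  exact h.dist_one_le ht

/-- A triangle inequality up to the factor `√d`. -/
lemma dist_le_sqrt_mul_add (P Q R : SPD d) : dist P R ≤ √d * (dist P Q + dist Q R) :=
  ((comparable_dist P Q).trans (comparable_dist Q R)).dist_le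
    (add_nonneg (dist_nonneg _ _) (dist_nonneg _ _))

lemma abs_toMatrix_apply_le (P : SPD d) (i j : Fin d) :
    |P.toMatrix i j| ≤ Real.exp (dist 1 P) := by
  refine abs_apply_le_of_quadraticForm P.posDef.1 (fun v => ?_) (fun v => ?_) i j
  · simpa using P.posDef.posSemidef.dotProduct_mulVec_nonneg v
  · simpa using (comparable_one P v).2

lemma continuous_toMatrix : Continuous (toMatrix : SPD d → _) := continuous_induced_dom

lemma isEmbedding_toMatrix : IsEmbedding (toMatrix : SPD d → _) :=
  ⟨⟨rfl⟩, fun _ _ => ext_toMatrix⟩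

lemma continuous_cong (A : Matrix (Fin d) (Fin d) ℝ) (hA : IsUnit A) : Continuous (cong A hA) := by
  rw [isEmbedding_toMatrix.continuous_iff]
  exact (continuous_const.mul continuous_toMatrix).mul continuous_const

/-- The functional calculus is continuous on positive definite matrices for functions that are
Lipschitz away from zero. -/
lemma continuous_cfc_of_lipschitz {X : Type*} [TopologicalSpace X]
    {A : X → Matrix (Fin d) (Fin d) ℝ} (hA : Continuous A) (hpos : ∀ x, (A x).PosDef) {f : ℝ → ℝ}
    (hf : ∀ m > 0, ∃ L, ∀ a b, m ≤ a → m ≤ b → |f a - f b| ≤ L * |a - b|) :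
    Continuous fun x => cfc f (A x) := by
  rw [continuous_iff_continuousAt]
  intro x₀
  obtain ⟨m, hm0, hm⟩ : ∃ m > 0, ∀ i, m ≤ (hpos x₀).1.eigenvalues i := by
    rcases isEmpty_or_nonempty (Fin d) with h | h
    · exact ⟨1, one_pos, fun i => (IsEmpty.false i).elim⟩
    · obtain ⟨i, hi⟩ := Finite.exists_min (hpos x₀).1.eigenvalues
      exact ⟨_, (hpos x₀).eigenvalues_pos i, hi⟩
  -- Near `x₀` all eigenvalues stay above `m / 2`, so a single Lipschitz constant serves the whole
  -- neighborhood.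
  obtain ⟨L, hL⟩ := hf (m / 2) (half_pos hm0)
  have hS : Tendsto (fun x => ∑ i, ∑ j, (A x₀ - A x) i j ^ 2) (𝓝 x₀) (𝓝 0) := by
    have : Continuous fun x => ∑ i, ∑ j, (A x₀ - A x) i j ^ 2 := by
      refine continuous_finsetSum _ fun i _ => continuous_finsetSum _ fun j _ => ?_
      exact ((continuous_const.sub hA).matrix_elem i j).pow 2
    simpa using this.tendsto x₀
  have hev : ∀ᶠ x in 𝓝 x₀, ∑ i, ∑ j, (A x₀ - A x) i j ^ 2 < (m / 2) ^ 2 :=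
    hS.eventually_lt_const (by positivity)
  refine tendsto_pi_nhds.2 fun i => tendsto_pi_nhds.2 fun j => ?_
  rw [← tendsto_sub_nhds_zero_iff]
  have hlim : Tendsto (fun x => √(L ^ 2 * ∑ i, ∑ j, (A x₀ - A x) i j ^ 2)) (𝓝 x₀) (𝓝 0) := by
    have := ((hS.const_mul (L ^ 2)).sqrt)
    simpa using this
  refine squeeze_zero_norm' (hev.mono fun x hx => ?_) hlim
  rw [Real.norm_eq_abs]
  refine Real.abs_le_sqrt ?_
  have hB := (hpos x₀).1.le_eigenvalues_of_sum_sq_lt (hpos x).1 hm (by positivity) hx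
  refine le_trans ?_ (sum_sq_cfc_sub_cfc_le (hpos x₀).1 (hpos x).1 hL
    (fun i => (half_le_self hm0.le).trans (hm i)) (fun i => by have := hB i; linarith))
  calc (cfc f (A x) i j - cfc f (A x₀) i j) ^ 2
      = (cfc f (A x₀) - cfc f (A x)) i j ^ 2 := by rw [Matrix.sub_apply]; ring
    _ ≤ ∑ j, (cfc f (A x₀) - cfc f (A x)) i j ^ 2 :=
        Finset.single_le_sum (f := fun j => (cfc f (A x₀) - cfc f (A x)) i j ^ 2)
          (fun _ _ => sq_nonneg _) (Finset.mem_univ j)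
    _ ≤ _ := Finset.single_le_sum (f := fun i => ∑ j, (cfc f (A x₀) - cfc f (A x)) i j ^ 2)
          (fun _ _ => Finset.sum_nonneg fun _ _ => sq_nonneg _) (Finset.mem_univ i)

lemma abs_log_sub_log_le {m a b : ℝ} (hm : 0 < m) (ha : m ≤ a) (hb : m ≤ b) :
    |Real.log a - Real.log b| ≤ m⁻¹ * |a - b| := by
  wlog h : b ≤ a generalizing a b
  · rw [abs_sub_comm, abs_sub_comm a]
    exact this hb ha (le_of_not_ge h)
  have hb0 : 0 < b := hm.trans_le hb
  have ha0 : 0 < a := hm.trans_le ha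
  rw [abs_of_nonneg (sub_nonneg.2 (Real.log_le_log hb0 h)), abs_of_nonneg (sub_nonneg.2 h),
    ← Real.log_div ha0.ne' hb0.ne']
  calc _ ≤ a / b - 1 := Real.log_le_sub_one_of_pos (div_pos ha0 hb0)
    _ = b⁻¹ * (a - b) := by field_simp
    _ ≤ _ := mul_le_mul_of_nonneg_right (inv_anti₀ hm hb) (sub_nonneg.2 h)

lemma abs_inv_sqrt_sub_inv_sqrt_le {m a b : ℝ} (hm : 0 < m) (ha : m ≤ a) (hb : m ≤ b) :
    |(√a)⁻¹ - (√b)⁻¹| ≤ (2 * √m ^ 3)⁻¹ * |a - b| := by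
  have h0 : 0 < √m := Real.sqrt_pos.2 hm
  have ha0 := Real.sqrt_le_sqrt ha
  have hb0 := Real.sqrt_le_sqrt hb
  have hA : 0 < √a := h0.trans_le ha0
  have hB : 0 < √b := h0.trans_le hb0
  have e : (√a)⁻¹ - (√b)⁻¹ = (√a * √b * (√a + √b))⁻¹ * (b - a) := by
    have h1 := Real.sq_sqrt (hm.le.trans ha)
    have h2 := Real.sq_sqrt (hm.le.trans hb)
    rw [show b - a = √b ^ 2 - √a ^ 2 by rw [h1, h2]]
    field_simp
    ring
  rw [e, abs_mul, abs_of_pos (by positivity), abs_sub_comm b a]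
  refine mul_le_mul_of_nonneg_right (inv_anti₀ (by positivity) ?_) (abs_nonneg _)
  calc 2 * √m ^ 3 = √m * √m * (√m + √m) := by ring
    _ ≤ _ := by gcongr

lemma continuous_invSqrt : Continuous (invSqrt : SPD d → _) :=
  continuous_cfc_of_lipschitz continuous_toMatrix posDef fun _ hm =>
    ⟨_, fun _ _ ha hb => abs_inv_sqrt_sub_inv_sqrt_le hm ha hb⟩

lemma posDef_invSqrt_mul_mul (P Q : SPD d) : (P.invSqrt * Q.toMatrix * P.invSqrt).PosDef := by
  have := (cong P.invSqrt P.isUnit_invSqrt Q).posDef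
  rwa [toMatrix_cong, transpose_invSqrt] at this

lemma continuous_dist : Continuous fun p : SPD d × SPD d => dist p.1 p.2 := by
  have h1 : Continuous fun p : SPD d × SPD d =>
      cfc Real.log (p.1.invSqrt * p.2.toMatrix * p.1.invSqrt) :=
    continuous_cfc_of_lipschitz
      (((continuous_invSqrt.comp continuous_fst).mul (continuous_toMatrix.comp continuous_snd)).mul
        (continuous_invSqrt.comp continuous_fst))
      (fun p => posDef_invSqrt_mul_mul p.1 p.2)
      fun _ hm => ⟨_, fun _ _ ha hb => abs_log_sub_log_le hm ha hb⟩
  refine Real.continuous_sqrt.comp ?_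
  refine continuous_finsetSum _ fun i _ => continuous_finsetSum _ fun j _ => ?_
  exact (h1.matrix_elem i j).pow 2

lemma continuous_dist_comp {X : Type*} [TopologicalSpace X] {f g : X → SPD d}
    (hf : Continuous f) (hg : Continuous g) : Continuous fun x => dist (f x) (g x) := by
  have := continuous_dist.comp (hf.prodMk hg)
  simpa only [Function.comp_def] using this

lemma continuous_dist_right (P : SPD d) : Continuous fun Q => dist P Q :=
  continuous_dist_comp continuous_const continuous_id

lemma continuous_dist_left (Q : SPD d) : Continuous fun P => dist P Q :=
  continuous_dist_comp continuous_id continuous_const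

/-- The ball is closed in the set of `P` whose quadratic form lies between `exp (-r)` and `exp r`
times the standard one. That set is closed and bounded among all matrices, since the lower bound
keeps limits definite. -/
lemma isCompact_dist_one_le (r : ℝ) : IsCompact {P : SPD d | dist 1 P ≤ r} := by
  have hbig : IsCompact {P : SPD d | Comparable r 1 P} := by
    rw [isEmbedding_toMatrix.isCompact_iff]
    have himage : toMatrix '' {P : SPD d | Comparable r 1 P} =
        {A : Matrix (Fin d) (Fin d) ℝ | Aᴴ = A} ∩ ⋂ v : Fin d → ℝ,
          {A | v ⬝ᵥ v ≤ Real.exp r * (v ⬝ᵥ A *ᵥ v)} ∩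
            {A | v ⬝ᵥ A *ᵥ v ≤ Real.exp r * (v ⬝ᵥ v)} := by
      ext A
      simp only [Set.mem_image, Set.mem_ofPred_eq, Set.mem_inter_iff, Set.mem_iInter]
      constructor
      · rintro ⟨P, hP, rfl⟩
        exact ⟨P.posDef.1, fun v => by simpa using hP v⟩
      · rintro ⟨h1, h2⟩
        refine ⟨⟨A, PosDef.of_dotProduct_mulVec_pos h1 fun {v} hv => ?_⟩, fun v => ?_, rfl⟩
        · have h3 : 0 < v ⬝ᵥ v := by simpa using dotProduct_star_self_pos_iff.2 hv
          simpa using pos_of_mul_pos_right (h3.trans_le (h2 v).1) (Real.exp_pos r).le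
        · rw [toMatrix_one, one_mulVec]; exact h2 v
    rw [himage]
    have hq : ∀ v : Fin d → ℝ, Continuous fun A : Matrix (Fin d) (Fin d) ℝ => v ⬝ᵥ A *ᵥ v :=
      fun v => continuous_const.dotProduct (continuous_id.matrix_mulVec continuous_const)
    refine (isCompact_univ_pi fun _ : Fin d => isCompact_univ_pi fun _ : Fin d =>
      isCompact_Icc (a := -Real.exp r) (b := Real.exp r)).of_isClosed_subset ?_ ?_
    · refine (isClosed_eq (continuous_id.matrix_conjTranspose) continuous_id).inter
        (isClosed_iInter fun v => ?_)
      exact (isClosed_le continuous_const (continuous_const.mul (hq v))).inter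
        (isClosed_le (hq v) continuous_const)
    · rintro A ⟨h1, h2⟩
      replace h2 : ∀ v : Fin d → ℝ, v ⬝ᵥ v ≤ Real.exp r * (v ⬝ᵥ A *ᵥ v) ∧
        v ⬝ᵥ A *ᵥ v ≤ Real.exp r * (v ⬝ᵥ v) := fun v => Set.mem_iInter.1 h2 v
      refine fun i _ j _ => abs_le.1 (abs_apply_le_of_quadraticForm h1 (fun v => ?_)
        (fun v => (h2 v).2) i j)
      have h3 : 0 ≤ v ⬝ᵥ v := by simpa using dotProduct_star_self_nonneg v
      exact nonneg_of_mul_nonneg_right (h3.trans (h2 v).1) (Real.exp_pos r)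
  refine hbig.of_isClosed_subset (isClosed_le (continuous_dist_right 1) continuous_const) ?_
  intro P hP v
  have h := comparable_one P v
  have hle : Real.exp (dist 1 P) ≤ Real.exp r := Real.exp_le_exp.2 hP
  have n1 : 0 ≤ v ⬝ᵥ P.toMatrix *ᵥ v := by
    simpa using P.posDef.posSemidef.dotProduct_mulVec_nonneg v
  have n2 : 0 ≤ v ⬝ᵥ (1 : SPD d).toMatrix *ᵥ v := by
    simpa using (1 : SPD d).posDef.posSemidef.dotProduct_mulVec_nonneg v
  exact ⟨h.1.trans (mul_le_mul_of_nonneg_right hle n1),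
    h.2.trans (mul_le_mul_of_nonneg_right hle n2)⟩

lemma isCompact_dist_le (M : SPD d) (r : ℝ) : IsCompact {P : SPD d | dist M P ≤ r} := by
  refine (isCompact_dist_one_le (√d * (dist 1 M + r))).of_isClosed_subset
    (isClosed_le (continuous_dist_right M) continuous_const) fun P hP => ?_
  have hP : dist M P ≤ r := hP
  exact (dist_le_sqrt_mul_add 1 M P).trans
    (mul_le_mul_of_nonneg_left (by linarith) (Real.sqrt_nonneg _))

end SPD

end DistanceTopology

/-! ### The chart and the congruence invariance of the volume -/

section Volume

namespace SPD

open Matrix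

variable {d : ℕ}

/-- The symmetric matrix with given entries on and above the diagonal. -/
noncomputable def symm (d : ℕ) : (UpperIndex d → ℝ) →ₗ[ℝ] Matrix (Fin d) (Fin d) ℝ where
  toFun x := ∑ p, x p • coordVector p
  map_add' x y := by simp [add_smul, Finset.sum_add_distrib]
  map_smul' c x := by simp [mul_smul, Finset.smul_sum]

/-- The entries on and above the diagonal. -/
def upper (d : ℕ) : Matrix (Fin d) (Fin d) ℝ →ₗ[ℝ] (UpperIndex d → ℝ) where
  toFun A p := A p.1.1 p.1.2
  map_add' _ _ := rfl
  map_smul' _ _ := rfl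

lemma symm_eq_sum (x : UpperIndex d → ℝ) : symm d x = ∑ p, x p • coordVector p := rfl

lemma symm_single (p : UpperIndex d) : symm d (Pi.single p 1) = coordVector p := by
  rw [symm_eq_sum, Finset.sum_eq_single p]
  · simp
  · intro q _ hq; simp [hq]
  · simp

lemma symm_apply_of_le (x : UpperIndex d → ℝ) (p : UpperIndex d) :
    symm d x p.1.1 p.1.2 = x p := by
  rw [symm_eq_sum, Matrix.sum_apply, Finset.sum_eq_single p]
  · simp [coordVector]
  · rintro ⟨⟨k, l⟩, hkl⟩ - hq
    obtain ⟨⟨i, j⟩, hij⟩ := p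
    have h1 : ¬ ((i, j) = (k, l) ∨ (j, i) = (k, l)) := by
      rintro (h | h)
      · simp only [Prod.mk.injEq] at h
        obtain ⟨rfl, rfl⟩ := h
        exact hq rfl
      · simp only [Prod.mk.injEq] at h
        obtain ⟨rfl, rfl⟩ := h
        obtain rfl : i = j := le_antisymm hij hkl
        exact hq rfl
    simp only [coordVector, Matrix.smul_apply, of_apply, smul_eq_mul, if_neg h1, mul_zero]
  · simp

lemma transpose_coordVector (p : UpperIndex d) : (coordVector p)ᵀ = coordVector p := by
  ext i j
  simp only [coordVector, transpose_apply, of_apply, or_comm]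

lemma transpose_symm (x : UpperIndex d → ℝ) : (symm d x)ᵀ = symm d x := by
  rw [symm_eq_sum, transpose_sum]
  simp [transpose_coordVector]

lemma upper_symm (x : UpperIndex d → ℝ) : upper d (symm d x) = x :=
  funext fun p => symm_apply_of_le x p

lemma symm_upper {A : Matrix (Fin d) (Fin d) ℝ} (hA : Aᵀ = A) : symm d (upper d A) = A := by
  ext i j
  rcases le_total i j with h | h
  · exact symm_apply_of_le (upper d A) ⟨(i, j), h⟩
  · rw [← transpose_symm, transpose_apply]
    refine (symm_apply_of_le (upper d A) ⟨(j, i), h⟩).trans ?_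
    exact congrFun (congrFun hA i) j

lemma transpose_toMatrix (P : SPD d) : P.toMatrixᵀ = P.toMatrix := by
  simpa using P.posDef.1.eq

lemma symm_coords (P : SPD d) : symm d P.coords = P.toMatrix := symm_upper P.transpose_toMatrix

lemma coords_injective : Function.Injective (coords : SPD d → _) := fun P Q h => by
  ext1
  rw [← symm_coords P, ← symm_coords Q, h]

lemma range_coords : Set.range (coords : SPD d → _) = {x | (symm d x).PosDef} := by
  ext x
  constructor
  · rintro ⟨P, rfl⟩
    rw [Set.mem_ofPred_eq, symm_coords]
    exact P.posDef
  · intro hx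
    exact ⟨⟨symm d x, hx⟩, upper_symm x⟩

lemma continuous_symm : Continuous (symm d) := LinearMap.continuous_of_finiteDimensional _

/-- Definite means semidefinite and invertible, a closed condition together with an open one. The
strict inequalities for all `v` would instead be an uncountable intersection of open sets. -/
lemma measurableSet_range_coords : MeasurableSet (Set.range (coords : SPD d → _)) := by
  have h : Set.range (coords : SPD d → _) =
      (⋂ v : Fin d → ℝ, {x | 0 ≤ v ⬝ᵥ symm d x *ᵥ v}) ∩ {x | (symm d x).det = 0}ᶜ := by
    rw [range_coords]
    ext x
    have hs : (symm d x).IsHermitian := by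
      rw [IsHermitian, conjTranspose_eq_transpose_of_trivial, transpose_symm]
    constructor
    · intro hx
      have hx : (symm d x).PosDef := hx
      refine ⟨Set.mem_iInter.2 fun v => ?_, hx.det_pos.ne'⟩
      simpa using hx.posSemidef.dotProduct_mulVec_nonneg v
    · rintro ⟨h1, h2⟩
      have h3 : (symm d x).PosSemidef := PosSemidef.of_dotProduct_mulVec_nonneg hs fun v => by
        simpa using Set.mem_iInter.1 h1 v
      exact h3.posDef_iff_isUnit.2 ((isUnit_iff_isUnit_det _).2 (Ne.isUnit h2))
  rw [h]
  have hq : ∀ v : Fin d → ℝ, Continuous fun x => v ⬝ᵥ symm d x *ᵥ v :=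
    fun v => continuous_const.dotProduct (continuous_symm.matrix_mulVec continuous_const)
  exact (isClosed_iInter fun v => isClosed_le continuous_const (hq v)).measurableSet.inter
    (isClosed_eq continuous_symm.matrix_det continuous_const).measurableSet.compl

lemma continuous_coords : Continuous (coords : SPD d → _) :=
  continuous_pi fun p => continuous_toMatrix.matrix_elem p.1.1 p.1.2

lemma isEmbedding_coords : IsEmbedding (coords : SPD d → _) := by
  refine IsEmbedding.of_comp continuous_coords continuous_symm ?_
  have : symm d ∘ coords = toMatrix := funext symm_coords
  rw [this]
  exact isEmbedding_toMatrix

lemma measurableEmbedding_coords : MeasurableEmbedding (coords : SPD d → _) :=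
  isEmbedding_coords.measurableEmbedding measurableSet_range_coords

/-- The congruence by `A` in coordinates. -/
noncomputable def congCoords (A : Matrix (Fin d) (Fin d) ℝ) :
    (UpperIndex d → ℝ) →ₗ[ℝ] (UpperIndex d → ℝ) :=
  upper d ∘ₗ (LinearMap.mulRight ℝ Aᵀ ∘ₗ LinearMap.mulLeft ℝ A) ∘ₗ symm d

lemma symm_congCoords (A : Matrix (Fin d) (Fin d) ℝ) (x : UpperIndex d → ℝ) :
    symm d (congCoords A x) = A * symm d x * Aᵀ := by
  refine symm_upper (A := A * symm d x * Aᵀ) ?_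
  rw [transpose_mul, transpose_mul, transpose_transpose, transpose_symm, mul_assoc]

lemma congCoords_coords (A : Matrix (Fin d) (Fin d) ℝ) (hA : IsUnit A) (P : SPD d) :
    congCoords A P.coords = (cong A hA P).coords := by
  have h : symm d (congCoords A P.coords) = (cong A hA P).toMatrix := by
    rw [symm_congCoords, symm_coords, toMatrix_cong]
  rw [← upper_symm (congCoords A P.coords), h]
  rfl

lemma congCoords_inv_comp {A : Matrix (Fin d) (Fin d) ℝ} (hA : IsUnit A) :
    congCoords A⁻¹ ∘ₗ congCoords A = LinearMap.id := by
  refine LinearMap.ext fun x => ?_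
  have hA' : IsUnit A.det := (isUnit_iff_isUnit_det A).1 hA
  have h2 : Aᵀ * (A⁻¹)ᵀ = 1 := by rw [← transpose_mul, nonsing_inv_mul _ hA', transpose_one]
  have h : symm d (congCoords A⁻¹ (congCoords A x)) = symm d x := by
    rw [symm_congCoords, symm_congCoords]
    calc _ = (A⁻¹ * A) * symm d x * (Aᵀ * (A⁻¹)ᵀ) := by simp only [mul_assoc]
      _ = _ := by rw [h2, nonsing_inv_mul _ hA', one_mul, mul_one]
  have := congrArg (upper d) h
  rwa [upper_symm, upper_symm] at this

lemma det_congCoords_ne_zero {A : Matrix (Fin d) (Fin d) ℝ} (hA : IsUnit A) :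
    LinearMap.det (congCoords A) ≠ 0 := by
  have h := congrArg LinearMap.det (congCoords_inv_comp hA)
  rw [LinearMap.det_comp, LinearMap.det_id] at h
  exact right_ne_zero_of_mul_eq_one h

/-- Lebesgue measure on `SPD d` in the chart `coords`. -/
noncomputable abbrev lebesgue (d : ℕ) : Measure (SPD d) := Measure.comap coords volume

lemma lebesgue_apply (s : Set (SPD d)) : lebesgue d s = volume (coords '' s) :=
  measurableEmbedding_coords.comap_apply _ _

lemma map_cong_lebesgue (A : Matrix (Fin d) (Fin d) ℝ) (hA : IsUnit A) :
    (lebesgue d).map (cong A hA) =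
      ENNReal.ofReal |(LinearMap.det (congCoords A))⁻¹| • lebesgue d := by
  refine Measure.ext fun s hs => ?_
  have hA' : IsUnit A⁻¹ := by simpa using hA
  rw [Measure.map_apply (continuous_cong A hA).measurable hs, Measure.smul_apply, lebesgue_apply,
    lebesgue_apply, smul_eq_mul, ← Measure.addHaar_preimage_linearMap _ (det_congCoords_ne_zero hA)]
  congr 1
  ext x
  constructor
  · rintro ⟨P, hP, rfl⟩
    exact ⟨_, hP, (congCoords_coords A hA P).symm⟩
  · rintro ⟨Q, hQ, hQx⟩
    have e : x = (cong A⁻¹ hA' Q).coords := by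
      rw [← congCoords_coords, hQx]
      exact (LinearMap.congr_fun (congCoords_inv_comp hA) x).symm
    refine ⟨cong A⁻¹ hA' Q, ?_, e.symm⟩
    have : cong A hA (cong A⁻¹ hA' Q) = Q := by
      apply coords_injective
      rw [← congCoords_coords, ← e, hQx]
    rwa [Set.mem_preimage, this]

lemma metric_cong (A : Matrix (Fin d) (Fin d) ℝ) (hA : IsUnit A) (P : SPD d)
    (U V : Matrix (Fin d) (Fin d) ℝ) :
    metric (cong A hA P) (A * U * Aᵀ) (A * V * Aᵀ) = metric P U V := by
  have hA' : IsUnit A.det := (isUnit_iff_isUnit_det A).1 hA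
  have h1 : A⁻¹ * A = 1 := nonsing_inv_mul _ hA'
  have h2 : Aᵀ * Aᵀ⁻¹ = 1 := mul_nonsing_inv _ (by rwa [det_transpose])
  rw [metric, metric, toMatrix_cong, Matrix.mul_inv_rev, Matrix.mul_inv_rev]
  calc _ = (Aᵀ⁻¹ * (P.toMatrix⁻¹ * (A⁻¹ * A) * U * (Aᵀ * Aᵀ⁻¹) * P.toMatrix⁻¹ * (A⁻¹ * A) * V *
          Aᵀ)).trace := by simp only [mul_assoc]
    _ = _ := by
      rw [h1, h2, trace_mul_comm]
      simp only [mul_one, mul_assoc]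
      rw [h2, mul_one]

lemma metric_symm_symm (P : SPD d) (x y : UpperIndex d → ℝ) :
    metric P (symm d x) (symm d y) = x ⬝ᵥ gram P *ᵥ y := by
  simp only [metric, symm_eq_sum, Finset.mul_sum, Finset.sum_mul, trace_sum, dotProduct, mulVec,
    gram, of_apply, mul_smul_comm, smul_mul_assoc, trace_smul, smul_eq_mul]
  rw [Finset.sum_comm]
  refine Finset.sum_congr rfl fun p _ => Finset.sum_congr rfl fun q _ => ?_
  ring

lemma gram_eq_transpose_mul_gram_cong (A : Matrix (Fin d) (Fin d) ℝ) (hA : IsUnit A)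
    (P : SPD d) : gram P = (LinearMap.toMatrix' (congCoords A))ᵀ * gram (cong A hA P) *
      LinearMap.toMatrix' (congCoords A) := by
  ext p q
  have h1 : gram P p q = metric P (symm d (Pi.single p 1)) (symm d (Pi.single q 1)) := by
    rw [symm_single, symm_single]; rfl
  rw [h1, ← metric_cong A hA, ← symm_congCoords, ← symm_congCoords, metric_symm_symm,
    ← LinearMap.toMatrix'_mulVec, ← LinearMap.toMatrix'_mulVec, mulVec_single_one,
    mulVec_single_one]
  simp only [mul_apply, dotProduct, mulVec, transpose_apply, col_apply,
    Finset.mul_sum, Finset.sum_mul]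
  rw [Finset.sum_comm]
  refine Finset.sum_congr rfl fun r _ => Finset.sum_congr rfl fun s _ => ?_
  ring

/-- Congruence is linear in the chart and isometric, so the Gram matrices differ by its Jacobian on
both sides. The resulting factor cancels the scaling of Lebesgue measure in `map_cong_lebesgue`. -/
lemma sqrt_det_gram_eq (A : Matrix (Fin d) (Fin d) ℝ) (hA : IsUnit A) (P : SPD d) :
    √(gram P).det = |LinearMap.det (congCoords A)| * √(gram (cong A hA P)).det := by
  rw [gram_eq_transpose_mul_gram_cong A hA P, det_mul, det_mul, det_transpose,
    LinearMap.det_toMatrix']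
  rw [show LinearMap.det (congCoords A) * (gram (cong A hA P)).det * LinearMap.det (congCoords A) =
    LinearMap.det (congCoords A) ^ 2 * (gram (cong A hA P)).det by ring,
    Real.sqrt_mul (sq_nonneg _), Real.sqrt_sq_eq_abs]

lemma continuous_inv_toMatrix : Continuous fun P : SPD d => P.toMatrix⁻¹ := by
  simp only [← invSqrt_mul_invSqrt]
  exact continuous_invSqrt.mul continuous_invSqrt

lemma continuous_sqrt_det_gram : Continuous fun P : SPD d => √(gram P).det := by
  refine Real.continuous_sqrt.comp (Continuous.matrix_det ?_)
  refine continuous_matrix fun p q => ?_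
  change Continuous fun P : SPD d =>
    (P.toMatrix⁻¹ * coordVector p * P.toMatrix⁻¹ * coordVector q).trace
  refine Continuous.matrix_trace ?_
  exact ((continuous_inv_toMatrix.mul continuous_const).mul continuous_inv_toMatrix).mul
    continuous_const

lemma measurable_ofReal_sqrt_det_gram :
    Measurable fun P : SPD d => ENNReal.ofReal √(gram P).det :=
  continuous_sqrt_det_gram.measurable.ennreal_ofReal

lemma lintegral_riemannianVolume {f : SPD d → ENNReal} (hf : Measurable f) :
    ∫⁻ P, f P ∂(riemannianVolume d) =
      ∫⁻ P, ENNReal.ofReal √(gram P).det * f P ∂(lebesgue d) :=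
  lintegral_withDensity_eq_lintegral_mul _ measurable_ofReal_sqrt_det_gram hf

/-- The Riemannian volume is invariant under congruences. -/
lemma lintegral_riemannianVolume_cong (A : Matrix (Fin d) (Fin d) ℝ) (hA : IsUnit A)
    {f : SPD d → ENNReal} (hf : Measurable f) :
    ∫⁻ P, f (cong A hA P) ∂(riemannianVolume d) = ∫⁻ P, f P ∂(riemannianVolume d) := by
  have hc := (continuous_cong A hA).measurable
  have hfc : Measurable fun P => f (cong A hA P) := hf.comp hc
  rw [lintegral_riemannianVolume hfc, lintegral_riemannianVolume hf]
  have h0 : |LinearMap.det (congCoords A)| ≠ 0 := abs_ne_zero.2 (det_congCoords_ne_zero hA)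
  have hg : Measurable fun P => ENNReal.ofReal |LinearMap.det (congCoords A)| *
      (ENNReal.ofReal √(gram P).det * f P) :=
    (measurable_ofReal_sqrt_det_gram.mul hf).const_mul _
  calc _ = ∫⁻ P, (fun P => ENNReal.ofReal |LinearMap.det (congCoords A)| *
      (ENNReal.ofReal √(gram P).det * f P)) (cong A hA P) ∂(lebesgue d) := by
        refine lintegral_congr fun P => ?_
        rw [sqrt_det_gram_eq A hA P, ENNReal.ofReal_mul (abs_nonneg _), mul_assoc]
    _ = _ := by
        rw [← lintegral_map hg hc, map_cong_lebesgue, lintegral_smul_measure,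
          lintegral_const_mul' _ _ ENNReal.ofReal_ne_top, smul_eq_mul, ← mul_assoc,
          ← ENNReal.ofReal_mul (abs_nonneg _), abs_inv, inv_mul_cancel₀ h0, ENNReal.ofReal_one,
          one_mul]

end SPD

end Volume

/-! ### Normalization and second moments of the Gaussian -/

section GaussianMoments

namespace SPD

open Matrix

variable {d : ℕ}

lemma abs_mul_apply_le {A B : Matrix (Fin d) (Fin d) ℝ} {a b : ℝ} (hA : ∀ i j, |A i j| ≤ a)
    (hB : ∀ i j, |B i j| ≤ b) (i j : Fin d) : |(A * B) i j| ≤ d * (a * b) := by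
  rw [mul_apply]
  calc _ ≤ ∑ k, |A i k * B k j| := Finset.abs_sum_le_sum_abs _ _
    _ ≤ ∑ _k : Fin d, a * b := by
      refine Finset.sum_le_sum fun k _ => ?_
      rw [abs_mul]
      exact mul_le_mul (hA _ _) (hB _ _) (abs_nonneg _) ((abs_nonneg _).trans (hA i k))
    _ = _ := by simp

lemma abs_coordVector_apply_le (p : UpperIndex d) (i j : Fin d) : |coordVector p i j| ≤ 1 := by
  simp only [coordVector, of_apply]
  split_ifs <;> simp

lemma abs_inv_toMatrix_apply_le (P : SPD d) (i j : Fin d) :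
    |P.toMatrix⁻¹ i j| ≤ Real.exp (dist P 1) := by
  rw [← dist_one_inverse]
  exact P.inverse.abs_toMatrix_apply_le i j

lemma abs_gram_apply_le (P : SPD d) (p q : UpperIndex d) :
    |gram P p q| ≤ d ^ 4 * Real.exp (dist P 1) ^ 2 := by
  have h := abs_mul_apply_le (abs_mul_apply_le (abs_mul_apply_le P.abs_inv_toMatrix_apply_le
    (abs_coordVector_apply_le p)) P.abs_inv_toMatrix_apply_le) (abs_coordVector_apply_le q)
  change |∑ i, (P.toMatrix⁻¹ * coordVector p * P.toMatrix⁻¹ * coordVector q) i i| ≤ _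
  refine (Finset.abs_sum_le_sum_abs _ _).trans ((Finset.sum_le_sum fun i _ => h i i).trans ?_)
  simp only [Finset.sum_const, Finset.card_univ, Fintype.card_fin, nsmul_eq_mul]
  exact le_of_eq (by ring)

lemma sqrt_le_one_add {x : ℝ} : √x ≤ 1 + |x| := by
  rw [Real.sqrt_le_left (by positivity)]
  nlinarith [le_abs_self x, abs_nonneg x]

/-- The Riemannian volume density grows at most exponentially with the distance to `1`. -/
lemma exists_sqrt_det_gram_le (d : ℕ) :
    ∃ C k : ℝ, 0 ≤ C ∧ 0 ≤ k ∧ ∀ P : SPD d, √(gram P).det ≤ C * Real.exp (k * dist P 1) := by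
  set n := Fintype.card (UpperIndex d)
  -- The Leibniz expansion has `n!` products of `n` entries, each at most `d ^ 4 * exp (2 δ)`; the
  -- summand 1 comes from `√x ≤ 1 + |x|`.
  refine ⟨1 + n.factorial * (d ^ 4 : ℝ) ^ n, (2 * n : ℕ), by positivity, by positivity, fun P => ?_⟩
  have h := Matrix.det_le (A := gram P) (abv := AbsoluteValue.abs) (P.abs_gram_apply_le)
  simp only [AbsoluteValue.abs_apply, nsmul_eq_mul] at h
  have h1 : 1 ≤ Real.exp ((2 * n : ℕ) * dist P 1) :=
    Real.one_le_exp (mul_nonneg (by positivity) (dist_nonneg _ _))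
  have h2 : (d ^ 4 * Real.exp (dist P 1) ^ 2) ^ n =
      (d ^ 4 : ℝ) ^ n * Real.exp ((2 * n : ℕ) * dist P 1) := by
    rw [mul_pow, ← pow_mul (Real.exp _), Real.exp_nat_mul]
  rw [h2] at h
  calc _ ≤ 1 + |(gram P).det| := sqrt_le_one_add
    _ ≤ Real.exp ((2 * n : ℕ) * dist P 1) +
        n.factorial * ((d ^ 4 : ℝ) ^ n * Real.exp ((2 * n : ℕ) * dist P 1)) := add_le_add h1 h
    _ = _ := by ring

lemma norm_coords_le (P : SPD d) : ‖P.coords‖ ≤ Real.exp (dist P 1) := by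
  rw [pi_norm_le_iff_of_nonneg (Real.exp_pos _).le, dist_one_comm]
  exact fun p => P.abs_toMatrix_apply_le _ _

lemma mul_sub_sq_div_le {σ : ℝ} (hσ : 0 < σ) (a r : ℝ) :
    a * r - r ^ 2 / (2 * σ ^ 2) ≤ a ^ 2 * σ ^ 2 / 2 := by
  have h : a ^ 2 * σ ^ 2 / 2 - (a * r - r ^ 2 / (2 * σ ^ 2)) = (a * σ - r / σ) ^ 2 / 2 := by
    field_simp
    ring
  nlinarith [sq_nonneg (a * σ - r / σ)]

/-- The chart norm and the volume density grow at most exponentially in δ(P, 1), and the Gaussian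
factor beats any exponential. The integrand in the chart is therefore dominated by an integrable
power of `1 + ‖x‖`. -/
lemma lintegral_dist_one_sq_mul_exp_lt_top {σ : ℝ} (hσ : 0 < σ) :
    ∫⁻ P : SPD d, ENNReal.ofReal (dist P 1 ^ 2 * Real.exp (-(dist P 1) ^ 2 / (2 * σ ^ 2)))
      ∂(riemannianVolume d) < ⊤ := by
  obtain ⟨C, k, hC, hk, hgram⟩ := exists_sqrt_det_gram_le d
  set n := Fintype.card (UpperIndex d)
  -- Any exponent above the dimension `n` makes `(1 + ‖x‖) ^ (-r)` integrable.
  set r : ℝ := n + 1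
  have hr : 0 < r := by positivity
  -- The exponential rates are `k` from the density, 1 from `t ^ 2 ≤ 2 * exp t`, and `r` from the
  -- chart norm; completing the square bounds their product with the Gaussian factor.
  set B : ℝ := C * 2 * 2 ^ r * Real.exp ((k + 1 + r) ^ 2 * σ ^ 2 / 2)
  have hdist : Continuous fun P : SPD d => dist P 1 := continuous_dist_left 1
  have hint : Integrable fun x : UpperIndex d → ℝ => (1 + ‖x‖) ^ (-r) := by
    refine integrable_one_add_norm ?_
    rw [Module.finrank_fintype_fun_eq_card]
    exact lt_add_one _
  have hcont : Continuous fun P : SPD d =>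
      dist P 1 ^ 2 * Real.exp (-(dist P 1) ^ 2 / (2 * σ ^ 2)) :=
    (hdist.pow 2).mul (Real.continuous_exp.comp ((hdist.pow 2).neg.div_const _))
  have hbound : ∀ P : SPD d, √(gram P).det *
      (dist P 1 ^ 2 * Real.exp (-(dist P 1) ^ 2 / (2 * σ ^ 2))) ≤
        B * (1 + ‖P.coords‖) ^ (-r) := by
    intro P
    set t := dist P 1
    have ht : 0 ≤ t := dist_nonneg _ _
    have h1 : t ^ 2 ≤ 2 * Real.exp t := by
      have := Real.quadratic_le_exp_of_nonneg ht
      nlinarith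
    have h2 : 1 + ‖P.coords‖ ≤ 2 * Real.exp t := by
      have := P.norm_coords_le
      have := Real.one_le_exp ht
      linarith
    have h3 : (1 + ‖P.coords‖) ^ r ≤ 2 ^ r * Real.exp (r * t) := by
      refine (Real.rpow_le_rpow (by positivity) h2 hr.le).trans_eq ?_
      rw [Real.mul_rpow (by positivity) (by positivity), ← Real.exp_mul, mul_comm t]
    have h4 : 0 < (1 + ‖P.coords‖) ^ r := by positivity
    rw [Real.rpow_neg (by positivity), ← div_eq_mul_inv, le_div_iff₀ h4]
    calc _ ≤ (C * Real.exp (k * t)) * (2 * Real.exp t * Real.exp (-t ^ 2 / (2 * σ ^ 2))) *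
          (2 ^ r * Real.exp (r * t)) := by
            gcongr
            exact hgram P
      _ = C * 2 * 2 ^ r * Real.exp ((k + 1 + r) * t - t ^ 2 / (2 * σ ^ 2)) := by
            rw [show (k + 1 + r) * t - t ^ 2 / (2 * σ ^ 2) =
              k * t + (t + -t ^ 2 / (2 * σ ^ 2)) + r * t by ring, Real.exp_add, Real.exp_add,
              Real.exp_add]
            ring
      _ ≤ B := mul_le_mul_of_nonneg_left (Real.exp_le_exp.2 (mul_sub_sq_div_le hσ _ _))
            (by positivity)
  rw [lintegral_riemannianVolume hcont.measurable.ennreal_ofReal]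
  calc _ ≤ ∫⁻ P, ENNReal.ofReal (B * (1 + ‖coords P‖) ^ (-r)) ∂(lebesgue d) := by
        refine lintegral_mono fun P => ?_
        rw [← ENNReal.ofReal_mul (Real.sqrt_nonneg _)]
        exact ENNReal.ofReal_le_ofReal (hbound P)
    _ = ∫⁻ x, ENNReal.ofReal (B * (1 + ‖x‖) ^ (-r)) ∂((lebesgue d).map coords) :=
        (measurableEmbedding_coords.lintegral_map
          fun x => ENNReal.ofReal (B * (1 + ‖x‖) ^ (-r))).symm
    _ ≤ ∫⁻ x, ENNReal.ofReal (B * (1 + ‖x‖) ^ (-r)) := by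
        rw [measurableEmbedding_coords.map_comap]
        exact setLIntegral_le_lintegral _ _
    _ < ⊤ := by
        have := (hint.const_mul B).2
        refine lt_of_le_of_lt (lintegral_mono fun x => ?_) this
        exact Real.ofReal_le_enorm _

/-- Radial integrals do not depend on the center. -/
lemma lintegral_riemannianVolume_dist (M : SPD d) {f : ℝ → ENNReal} (hf : Measurable f) :
    ∫⁻ P, f (dist P M) ∂(riemannianVolume d) = ∫⁻ P, f (dist P 1) ∂(riemannianVolume d) := by
  have hd : Measurable fun P : SPD d => dist P 1 := (continuous_dist_left 1).measurable
  have hfd : Measurable fun P : SPD d => f (dist P 1) := hf.comp hd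
  rw [← lintegral_riemannianVolume_cong M.invSqrt M.isUnit_invSqrt hfd]
  refine lintegral_congr fun P => ?_
  rw [← dist_cong M.invSqrt M.isUnit_invSqrt P M, cong_invSqrt_self]

lemma zeta_nonneg (d : ℕ) (σ : ℝ) : 0 ≤ zeta d σ :=
  integral_nonneg fun _ => (Real.exp_pos _).le

lemma continuous_gaussianDensity (M : SPD d) (σ : ℝ) : Continuous (gaussianDensity M σ) := by
  have hdist : Continuous fun P : SPD d => dist P M := continuous_dist_left M
  exact continuous_const.mul
    (Real.continuous_exp.comp ((hdist.pow 2).neg.div_const _))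

lemma measurable_ofReal_gaussianDensity (M : SPD d) (σ : ℝ) :
    Measurable fun P => ENNReal.ofReal (gaussianDensity M σ P) :=
  (continuous_gaussianDensity M σ).measurable.ennreal_ofReal

lemma gaussian_univ (M : SPD d) (σ : ℝ) : gaussian M σ Set.univ = gaussian (1 : SPD d) σ Set.univ := by
  have hf : Measurable fun r : ℝ =>
      ENNReal.ofReal (1 / zeta d σ * Real.exp (-r ^ 2 / (2 * σ ^ 2))) := by fun_prop
  rw [gaussian, gaussian, withDensity_apply _ MeasurableSet.univ, withDensity_apply _
    MeasurableSet.univ, setLIntegral_univ, setLIntegral_univ]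
  exact lintegral_riemannianVolume_dist M hf

/-- If `zeta` were 0, then `1 / zeta = 0` by convention and the measure would vanish. -/
lemma zeta_pos_of_isProbabilityMeasure {M : SPD d} {σ : ℝ}
    (h : IsProbabilityMeasure (gaussian M σ)) : 0 < zeta d σ := by
  refine (zeta_nonneg d σ).lt_of_ne fun h0 => ?_
  have h1 := h.measure_univ
  rw [gaussian, withDensity_apply _ MeasurableSet.univ] at h1
  simp [gaussianDensity, ← h0] at h1

lemma integrable_dist_sq_gaussian (M : SPD d) {σ : ℝ} (hσ : 0 < σ) :
    Integrable (fun P => dist P M ^ 2) (gaussian M σ) := by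
  have hdist : Continuous fun P : SPD d => dist P M := continuous_dist_left M
  refine ⟨(hdist.pow 2).aestronglyMeasurable, ?_⟩
  have hm : Measurable fun P : SPD d => ENNReal.ofReal (dist P M ^ 2) :=
    (hdist.pow 2).measurable.ennreal_ofReal
  rw [hasFiniteIntegral_iff_ofReal (ae_of_all _ fun P => sq_nonneg _), gaussian,
    lintegral_withDensity_eq_lintegral_mul _ (measurable_ofReal_gaussianDensity M σ) hm]
  have hz : 0 ≤ 1 / zeta d σ := one_div_nonneg.2 (zeta_nonneg d σ)
  have hf : Measurable fun r : ℝ =>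
      ENNReal.ofReal (r ^ 2 * Real.exp (-r ^ 2 / (2 * σ ^ 2))) := by fun_prop
  have e : ∀ P : SPD d, ((fun P => ENNReal.ofReal (gaussianDensity M σ P)) *
      fun P => ENNReal.ofReal (dist P M ^ 2)) P = ENNReal.ofReal (1 / zeta d σ) *
        ENNReal.ofReal (dist P M ^ 2 * Real.exp (-(dist P M) ^ 2 / (2 * σ ^ 2))) := by
    intro P
    rw [Pi.mul_apply, ← ENNReal.ofReal_mul hz, gaussianDensity, ← ENNReal.ofReal_mul
      (mul_nonneg hz (Real.exp_pos _).le)]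
    congr 1
    ring
  rw [lintegral_congr e, lintegral_const_mul' _ _ ENNReal.ofReal_ne_top]
  refine ENNReal.mul_lt_top ENNReal.ofReal_lt_top ?_
  rw [lintegral_riemannianVolume_dist M hf]
  exact lintegral_dist_one_sq_mul_exp_lt_top hσ

end SPD

end GaussianMoments

/-! ### Bisectors have volume zero -/

section Bisectors

namespace Matrix

/-- Matrices that intertwine two symmetric matrices intertwine their functional calculi. -/
lemma mul_cfc_eq_cfc_mul {n : Type*} [Fintype n] [DecidableEq n] {L L' C : Matrix n n ℝ}
    (hL : IsSelfAdjoint L) (hL' : IsSelfAdjoint L') (h : C * L = L' * C) (f : ℝ → ℝ) :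
    C * cfc f L = cfc f L' * C := by
  classical
  -- A polynomial that agrees with `f` on both finite spectra reduces the claim to powers.
  set s : Finset ℝ := (finite_real_spectrum (A := L)).toFinset ∪
    (finite_real_spectrum (A := L')).toFinset
  set p : Polynomial ℝ := Lagrange.interpolate s id f
  have hp : ∀ x ∈ s, p.eval x = f x := fun x hx =>
    Lagrange.eval_interpolate_at_node f (Set.injOn_id _) hx
  have e1 : cfc f L = Polynomial.aeval L p := by
    rw [← cfc_polynomial p L]
    exact cfc_congr fun x hx => (hp x (by simp [s, hx])).symm
  have e2 : cfc f L' = Polynomial.aeval L' p := by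
    rw [← cfc_polynomial p L']
    exact cfc_congr fun x hx => (hp x (by simp [s, hx])).symm
  rw [e1, e2]
  have hpow : ∀ k : ℕ, C * L ^ k = L' ^ k * C := fun k => by
    induction k with
    | zero => simp
    | succ k ih => rw [pow_succ, pow_succ, ← mul_assoc, ih, mul_assoc, h, mul_assoc]
  induction p using Polynomial.induction_on' with
  | add p q h1 h2 => rw [map_add, map_add, mul_add, add_mul, h1, h2]
  | monomial k a =>
    rw [Polynomial.aeval_monomial, Polynomial.aeval_monomial, ← Algebra.smul_def,
      ← Algebra.smul_def, mul_smul_comm, smul_mul_assoc, hpow]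

end Matrix

namespace SPD

open Matrix

variable {d : ℕ}

/-- The remainder is `(log b - log a)²` plus `2 log a` times the first order remainder of `log`;
both are quadratic in `b - a` by `1 - 1/x ≤ log x ≤ x - 1`. -/
lemma abs_log_sq_taylor {m : ℝ} (hm : 0 < m) {a b : ℝ} (ha : m ≤ a) (hb : m ≤ b) :
    |Real.log b ^ 2 - Real.log a ^ 2 - 2 * Real.log a / a * (b - a)| ≤
      (1 + 2 * |Real.log a|) / m ^ 2 * (b - a) ^ 2 := by
  have ha0 : 0 < a := hm.trans_le ha
  have hb0 : 0 < b := hm.trans_le hb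
  have h1 : (Real.log b - Real.log a) ^ 2 ≤ (b - a) ^ 2 / m ^ 2 := by
    have h := abs_log_sub_log_le hm hb ha
    rw [← sq_abs]
    calc _ ≤ (m⁻¹ * |b - a|) ^ 2 := pow_le_pow_left₀ (abs_nonneg _) h 2
      _ = _ := by rw [mul_pow, sq_abs]; field_simp
  have h2 : |Real.log b - Real.log a - (b - a) / a| ≤ (b - a) ^ 2 / m ^ 2 := by
    have hu : Real.log b - Real.log a = Real.log (b / a) :=
      (Real.log_div hb0.ne' ha0.ne').symm
    have h3 := Real.log_le_sub_one_of_pos (div_pos hb0 ha0)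
    have h4 := Real.one_sub_inv_le_log_of_pos (div_pos hb0 ha0)
    have h5 : (b - a) / a = b / a - 1 := by field_simp
    rw [hu, h5, abs_sub_comm, abs_of_nonneg (by linarith)]
    calc _ ≤ b / a - 1 - (1 - (b / a)⁻¹) := by linarith
      _ = (b - a) ^ 2 / (a * b) := by field_simp
      _ ≤ _ := by
        refine div_le_div_of_nonneg_left (sq_nonneg _) (by positivity) ?_
        rw [sq]
        exact mul_le_mul ha hb hm.le ha0.le
  have e : Real.log b ^ 2 - Real.log a ^ 2 - 2 * Real.log a / a * (b - a) =
      (Real.log b - Real.log a) ^ 2 + 2 * Real.log a *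
        (Real.log b - Real.log a - (b - a) / a) := by ring
  rw [e]
  refine (abs_add_le _ _).trans ?_
  rw [abs_mul, abs_mul, abs_two, abs_of_nonneg (sq_nonneg (Real.log b - Real.log a))]
  calc _ ≤ (b - a) ^ 2 / m ^ 2 + 2 * |Real.log a| * ((b - a) ^ 2 / m ^ 2) := by gcongr
    _ = _ := by ring

/-- The differential of `Z ↦ δ(Z, M)²`, represented through the trace form. -/
noncomputable def gradDistSq (M Z : SPD d) : Matrix (Fin d) (Fin d) ℝ :=
  M.invSqrt * cfc (fun x => 2 * Real.log x / x) (M.invSqrt * Z.toMatrix * M.invSqrt) * M.invSqrt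

lemma continuous_gradDistSq (M : SPD d) : Continuous (gradDistSq M) := by
  have hW : Continuous fun Z : SPD d => M.invSqrt * Z.toMatrix * M.invSqrt :=
    (continuous_const.mul continuous_toMatrix).mul continuous_const
  refine (continuous_const.mul ?_).mul continuous_const
  -- The function `2 log x / x` is split into factors that are Lipschitz away from zero.
  have e : ∀ Z : SPD d,
      cfc (fun x => 2 * Real.log x / x) (M.invSqrt * Z.toMatrix * M.invSqrt) =
        (2 : ℝ) • (cfc Real.log (M.invSqrt * Z.toMatrix * M.invSqrt) *
          (cfc (fun x : ℝ => (√x)⁻¹) (M.invSqrt * Z.toMatrix * M.invSqrt) *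
            cfc (fun x : ℝ => (√x)⁻¹) (M.invSqrt * Z.toMatrix * M.invSqrt))) := by
    intro Z
    have hp := posDef_invSqrt_mul_mul M Z
    rw [hp.cfc_invSqrt_mul_cfc_invSqrt, ← cfc_mul _ _ _ (continuousOn_spectrum_real _ _)
      (continuousOn_spectrum_real _ _), ← cfc_smul _ _ _ (continuousOn_spectrum_real _ _)]
    refine cfc_congr fun x _ => ?_
    simp only [smul_eq_mul, div_eq_mul_inv, mul_assoc]
  simp only [e]
  have h1 := continuous_cfc_of_lipschitz hW (posDef_invSqrt_mul_mul M) (f := Real.log)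
    fun _ hm => ⟨_, fun _ _ ha hb => abs_log_sub_log_le hm ha hb⟩
  have h2 := continuous_cfc_of_lipschitz hW (posDef_invSqrt_mul_mul M) (f := fun x : ℝ => (√x)⁻¹)
    fun _ hm => ⟨_, fun _ _ ha hb => abs_inv_sqrt_sub_inv_sqrt_le hm ha hb⟩
  exact (h1.mul (h2.mul h2)).const_smul (2 : ℝ)

lemma isHermitian_gradDistSq (M Z : SPD d) : (gradDistSq M Z).IsHermitian := by
  have h := isHermitian_mul_mul_conjTranspose M.invSqrt (isHermitian_cfc
    (fun x => 2 * Real.log x / x) (M.invSqrt * Z.toMatrix * M.invSqrt))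
  rwa [conjTranspose_eq_transpose_of_trivial, transpose_invSqrt] at h

lemma dist_sq_eq_trace_left (Z M : SPD d) :
    dist Z M ^ 2 =
      (cfc (fun x => Real.log x ^ 2) (M.invSqrt * Z.toMatrix * M.invSqrt)).trace := by
  rw [dist_comm, dist_sq_eq_trace_invSqrt]

/-- First order expansion of the squared distance along lines. -/
lemma exists_abs_dist_sq_sub_le (M Z : SPD d) (V : Matrix (Fin d) (Fin d) ℝ) :
    ∃ C ε : ℝ, 0 ≤ C ∧ 0 < ε ∧ ∀ t : ℝ, ∀ Z' : SPD d, |t| < ε → Z'.toMatrix = Z.toMatrix + t • V →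
      |dist Z' M ^ 2 - dist Z M ^ 2 - t * (gradDistSq M Z * V).trace| ≤ C * t ^ 2 := by
  have hp := posDef_invSqrt_mul_mul M Z
  obtain ⟨m, hm0, hm⟩ : ∃ m > 0, ∀ i, m ≤ hp.1.eigenvalues i := by
    rcases isEmpty_or_nonempty (Fin d) with h | h
    · exact ⟨1, one_pos, fun i => (IsEmpty.false i).elim⟩
    · obtain ⟨i, hi⟩ := Finite.exists_min hp.1.eigenvalues
      exact ⟨_, hp.eigenvalues_pos i, hi⟩
  obtain ⟨l, hl0, hl⟩ : ∃ l, 0 ≤ l ∧ ∀ i, |Real.log (hp.1.eigenvalues i)| ≤ l :=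
    ⟨∑ i, |Real.log (hp.1.eigenvalues i)|, Finset.sum_nonneg fun _ _ => abs_nonneg _, fun i =>
      Finset.single_le_sum (f := fun i => |Real.log (hp.1.eigenvalues i)|)
        (fun _ _ => abs_nonneg _) (Finset.mem_univ i)⟩
  set s : ℝ := ∑ i, ∑ j, (M.invSqrt * V * M.invSqrt) i j ^ 2
  have hs : 0 ≤ s := Finset.sum_nonneg fun _ _ => Finset.sum_nonneg fun _ _ => sq_nonneg _
  -- The bound on `t` keeps the perturbed eigenvalues above `m / 2`; `s + 1` replaces `s` because
  -- `s` may be zero.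
  refine ⟨(1 + 2 * l) / (m / 2) ^ 2 * s, m / 2 / √(s + 1), by positivity, by positivity,
    fun t Z' ht hZ' => ?_⟩
  have hp' := posDef_invSqrt_mul_mul M Z'
  have hdiff : M.invSqrt * Z'.toMatrix * M.invSqrt - M.invSqrt * Z.toMatrix * M.invSqrt =
      t • (M.invSqrt * V * M.invSqrt) := by
    rw [hZ', mul_add, add_mul, add_sub_cancel_left, mul_smul_comm, smul_mul_assoc]
  have hsum : ∑ i, ∑ j, (M.invSqrt * Z.toMatrix * M.invSqrt -
      M.invSqrt * Z'.toMatrix * M.invSqrt) i j ^ 2 = t ^ 2 * s := by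
    rw [← neg_sub, hdiff, Finset.mul_sum]
    refine Finset.sum_congr rfl fun i _ => ?_
    rw [Finset.mul_sum]
    refine Finset.sum_congr rfl fun j _ => ?_
    rw [Matrix.neg_apply, Matrix.smul_apply, smul_eq_mul]
    ring
  have hlt : t ^ 2 * s < (m / 2) ^ 2 := by
    have h1 : |t| * √(s + 1) < m / 2 := (lt_div_iff₀ (by positivity)).1 ht
    calc t ^ 2 * s ≤ t ^ 2 * (s + 1) := by gcongr; linarith
      _ = (|t| * √(s + 1)) ^ 2 := by rw [mul_pow, sq_abs, Real.sq_sqrt (by positivity)]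
      _ < _ := pow_lt_pow_left₀ h1 (by positivity) two_ne_zero
  have hmB := hp.1.le_eigenvalues_of_sum_sq_lt hp'.1 hm (by positivity) (hsum.trans_lt hlt)
  have key := abs_trace_cfc_sub_le (m := m / 2) (C := (1 + 2 * l) / (m / 2) ^ 2) hp.1 hp'.1
    (φ := fun x => Real.log x ^ 2) (ψ := fun x => 2 * Real.log x / x) (fun i b hb => by
      refine (abs_log_sq_taylor (half_pos hm0) ((half_le_self hm0.le).trans (hm i)) hb).trans ?_
      have := hl i
      gcongr) (fun i => by have := hmB i; linarith)
  rw [hsum, hdiff, ← dist_sq_eq_trace_left, ← dist_sq_eq_trace_left, mul_smul_comm, trace_smul,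
    smul_eq_mul] at key
  have e : (cfc (fun x => 2 * Real.log x / x) (M.invSqrt * Z.toMatrix * M.invSqrt) *
      (M.invSqrt * V * M.invSqrt)).trace = (gradDistSq M Z * V).trace := by
    rw [gradDistSq, ← mul_assoc, trace_mul_comm]
    simp only [mul_assoc]
  rw [e] at key
  refine key.trans_eq ?_
  ring

lemma isUnit_toMatrix (P : SPD d) : IsUnit P.toMatrix :=
  (isUnit_iff_isUnit_det _).2 P.isUnit_det

/-- The differential of `Z ↦ δ(Z, M)²` at `Z` determines `M`. -/
lemma eq_of_gradDistSq_eq {M M' Z : SPD d} (h : gradDistSq M Z = gradDistSq M' Z) : M = M' := by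
  set f : ℝ → ℝ := fun x => 2 * Real.log x / x
  set g : ℝ → ℝ := fun x => 2 * Real.log x
  -- Multiplication by `Z` turns `2 log x / x`, which is not injective, into `2 log x`, which `hexp`
  -- inverts.
  have hlog : ∀ P : SPD d, gradDistSq P Z * Z.toMatrix * P.invSqrt =
      P.invSqrt * cfc g (P.invSqrt * Z.toMatrix * P.invSqrt) := by
    intro P
    have hp := posDef_invSqrt_mul_mul P Z
    have hp1 : IsSelfAdjoint (P.invSqrt * Z.toMatrix * P.invSqrt) := hp.1
    have e : cfc g (P.invSqrt * Z.toMatrix * P.invSqrt) =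
        cfc f (P.invSqrt * Z.toMatrix * P.invSqrt) * (P.invSqrt * Z.toMatrix * P.invSqrt) := by
      conv_rhs => enter [2]; rw [← cfc_id' ℝ (P.invSqrt * Z.toMatrix * P.invSqrt)]
      rw [← cfc_mul _ _ _ (continuousOn_spectrum_real _ _) (continuousOn_spectrum_real _ _)]
      refine cfc_congr fun x hx => ?_
      have := (hp.spectrum_pos hx).ne'
      simp only [f, g]
      field_simp
    rw [e, gradDistSq]
    simp only [mul_assoc, f]
  have hexp : ∀ P : SPD d, cfc (fun y => Real.exp (y / 2))
      (cfc g (P.invSqrt * Z.toMatrix * P.invSqrt)) = P.invSqrt * Z.toMatrix * P.invSqrt := by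
    intro P
    have hp := posDef_invSqrt_mul_mul P Z
    have hp1 : IsSelfAdjoint (P.invSqrt * Z.toMatrix * P.invSqrt) := hp.1
    rw [← cfc_comp' _ _ _ (((finite_real_spectrum
      (A := P.invSqrt * Z.toMatrix * P.invSqrt)).image _).continuousOn _)
      (continuousOn_spectrum_real _ _)]
    conv_rhs => rw [← cfc_id' ℝ (P.invSqrt * Z.toMatrix * P.invSqrt)]
    refine cfc_congr fun x hx => ?_
    simp only [g]
    rw [mul_div_cancel_left₀ _ two_ne_zero, Real.exp_log (hp.spectrum_pos hx)]
  have hA' : IsUnit M'.invSqrt.det := (isUnit_iff_isUnit_det _).1 M'.isUnit_invSqrt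
  -- Equality of the gradients says that `C` intertwines the two logarithms. It then intertwines
  -- their exponentials, and cancelling `Z` leaves `M⁻¹ = M'⁻¹`.
  set C := M'.invSqrt⁻¹ * M.invSqrt
  have hC : M'.invSqrt * C = M.invSqrt := by
    rw [← mul_assoc, mul_nonsing_inv _ hA', one_mul]
  have hint : C * cfc g (M.invSqrt * Z.toMatrix * M.invSqrt) =
      cfc g (M'.invSqrt * Z.toMatrix * M'.invSqrt) * C := by
    refine M'.isUnit_invSqrt.mul_left_cancel ?_
    rw [← mul_assoc, hC, ← hlog, ← mul_assoc, ← hlog, mul_assoc _ _ C, hC, h]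
  have h2 := mul_cfc_eq_cfc_mul (isHermitian_cfc g _) (isHermitian_cfc g _) hint
    (fun y => Real.exp (y / 2))
  rw [hexp, hexp] at h2
  have h3 := congrArg (fun X => M'.invSqrt * X) h2
  have h4 : M.toMatrix⁻¹ * (Z.toMatrix * M.invSqrt) =
      M'.toMatrix⁻¹ * (Z.toMatrix * M.invSqrt) := by
    rw [← invSqrt_mul_invSqrt, ← invSqrt_mul_invSqrt]
    calc _ = M'.invSqrt * (C * (M.invSqrt * Z.toMatrix * M.invSqrt)) := by
          rw [← mul_assoc M'.invSqrt C, hC]; simp only [mul_assoc]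
      _ = M'.invSqrt * M'.invSqrt * (Z.toMatrix * (M'.invSqrt * C)) := by
          rw [h3]; simp only [mul_assoc]
      _ = _ := by rw [hC]
  have h5 := (Z.isUnit_toMatrix.mul M.isUnit_invSqrt).mul_right_cancel h4
  ext1
  rw [← nonsing_inv_nonsing_inv M.toMatrix M.isUnit_det, h5,
    nonsing_inv_nonsing_inv M'.toMatrix M'.isUnit_det]

/-- `D` is itself a combination of coordinate vectors, so `tr (D D) = 0`. -/
lemma eq_zero_of_trace_mul_coordVector {D : Matrix (Fin d) (Fin d) ℝ} (hD : D.IsHermitian)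
    (h : ∀ p : UpperIndex d, (D * coordVector p).trace = 0) : D = 0 := by
  have hDt : Dᵀ = D := by simpa using hD.eq
  have h1 : (D * D).trace = 0 := by
    conv_lhs => enter [1, 2]; rw [← symm_upper hDt, symm_eq_sum]
    rw [Finset.mul_sum, trace_sum]
    refine Finset.sum_eq_zero fun p _ => ?_
    rw [mul_smul_comm, trace_smul, h, smul_zero]
  rw [← trace_conjTranspose_mul_self_eq_zero_iff, hD.eq, h1]

lemma countable_of_isolated {D : Set ℝ}
    (h : ∀ t ∈ D, ∃ ε > 0, ∀ s ∈ D, |s - t| < ε → s = t) : D.Countable := by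
  have : DiscreteTopology D := by
    refine discreteTopology_subtype_iff'.2 fun t ht => ?_
    obtain ⟨ε, hε, hs⟩ := h t ht
    refine ⟨Metric.ball t ε, Metric.isOpen_ball, ?_⟩
    ext s
    constructor
    · rintro ⟨h1, h2⟩
      exact hs s h2 (by simpa [Real.dist_eq] using h1)
    · rintro rfl
      exact ⟨Metric.mem_ball_self hε, ht⟩
  exact Set.countable_coe_iff.1 (countable_of_Lindelof_of_discrete (X := D))

/-- The part of the bisector of `M` and `M'` that is transversal to the coordinate direction
`p`. -/
def bisectorPart (M M' : SPD d) (p : UpperIndex d) : Set (SPD d) :=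
  {Z | dist Z M = dist Z M' ∧ ((gradDistSq M Z - gradDistSq M' Z) * coordVector p).trace ≠ 0}

lemma measurableSet_bisectorPart (M M' : SPD d) (p : UpperIndex d) :
    MeasurableSet (bisectorPart M M' p) := by
  have h1 : Continuous fun Z : SPD d =>
      ((gradDistSq M Z - gradDistSq M' Z) * coordVector p).trace :=
    (((continuous_gradDistSq M).sub (continuous_gradDistSq M')).mul continuous_const).matrix_trace
  exact (isClosed_eq (continuous_dist_left M) (continuous_dist_left M')).measurableSet.inter
    (isClosed_eq h1 continuous_const).measurableSet.compl

lemma bisectorPart_isolated {M M' : SPD d} {p : UpperIndex d} {Z : SPD d}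
    (hZ : Z ∈ bisectorPart M M' p) : ∃ ε > 0, ∀ t : ℝ, ∀ Z' ∈ bisectorPart M M' p, |t| < ε →
      Z'.toMatrix = Z.toMatrix + t • coordVector p → t = 0 := by
  obtain ⟨C, ε, hC, hε, h⟩ := exists_abs_dist_sq_sub_le M Z (coordVector p)
  obtain ⟨C', ε', hC', hε', h'⟩ := exists_abs_dist_sq_sub_le M' Z (coordVector p)
  obtain ⟨hZ1, hZ2⟩ := hZ
  rw [sub_mul, trace_sub] at hZ2
  set a := (gradDistSq M Z * coordVector p).trace
  set b := (gradDistSq M' Z * coordVector p).trace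
  -- On the bisector the two expansions give `|t| |a - b| ≤ (C + C') t²`, impossible for nonzero `t`
  -- below this threshold.
  refine ⟨min (min ε ε') (|a - b| / (C + C' + 1)),
    lt_min (lt_min hε hε') (div_pos (abs_pos.2 hZ2) (by positivity)), fun t Z' hZ' ht hZt => ?_⟩
  by_contra ht0
  obtain ⟨ht1, ht2⟩ := lt_min_iff.1 ht
  obtain ⟨ht3, ht4⟩ := lt_min_iff.1 ht1
  have k := h t Z' ht3 hZt
  have k' := h' t Z' ht4 hZt
  rw [hZ'.1, hZ1] at k
  have k2 : |t * (a - b)| ≤ (C + C') * t ^ 2 := by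
    have := (abs_sub _ _).trans (add_le_add k' k)
    refine (le_of_eq ?_).trans (this.trans_eq ?_)
    · congr 1; ring
    · ring
  rw [abs_mul, ← sq_abs t, sq, ← mul_assoc, mul_comm] at k2
  have k3 : |a - b| ≤ (C + C') * |t| := le_of_mul_le_mul_right k2 (abs_pos.2 ht0)
  rw [lt_div_iff₀ (by positivity)] at ht2
  nlinarith [abs_pos.2 ht0]

lemma lebesgue_bisectorPart (M M' : SPD d) (p : UpperIndex d) :
    lebesgue d (bisectorPart M M' p) = 0 := by
  rw [lebesgue_apply]
  have hmeas : MeasurableSet (coords '' bisectorPart M M' p) :=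
    measurableEmbedding_coords.measurableSet_image.2 (measurableSet_bisectorPart M M' p)
  -- Fubini: it suffices that every line in direction `p` meets the set in a null set.
  have key := ae_mem_of_ae_add_linearMap_mem
    (LinearMap.toSpanSingleton ℝ (UpperIndex d → ℝ) (Pi.single p 1)) (volume : Measure ℝ)
    (volume : Measure (UpperIndex d → ℝ)) hmeas.compl ?_
  · exact measure_eq_zero_iff_ae_notMem.2 key
  intro y
  set D : Set ℝ := {t | y + t • Pi.single p 1 ∈ coords '' bisectorPart M M' p}
  have hD : D.Countable := by
    refine countable_of_isolated fun t ht => ?_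
    obtain ⟨Z, hZ, hZt⟩ := ht
    obtain ⟨ε, hε, h⟩ := bisectorPart_isolated hZ
    refine ⟨ε, hε, fun s hs hst => ?_⟩
    obtain ⟨Z', hZ', hZs⟩ := hs
    refine sub_eq_zero.1 (h (s - t) Z' hZ' hst ?_)
    rw [← symm_coords Z, ← symm_coords Z', hZt, hZs, ← symm_single, ← map_smul, ← map_add]
    congr 1
    module
  have := hD.ae_notMem (volume : Measure ℝ)
  filter_upwards [this] with t ht
  exact ht

/-- The bisector of two distinct points has volume zero. -/
lemma riemannianVolume_bisector {M M' : SPD d} (h : M ≠ M') :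
    riemannianVolume d {Z | dist Z M = dist Z M'} = 0 := by
  refine withDensity_absolutelyContinuous _ _ ?_
  have hsub : {Z | dist Z M = dist Z M'} ⊆ ⋃ p, bisectorPart M M' p := by
    intro Z hZ
    by_contra hcon
    rw [Set.mem_iUnion, not_exists] at hcon
    refine h (eq_of_gradDistSq_eq (Z := Z) (sub_eq_zero.1 ?_))
    refine eq_zero_of_trace_mul_coordVector
      ((isHermitian_gradDistSq M Z).sub (isHermitian_gradDistSq M' Z)) fun p => ?_
    by_contra h0
    exact hcon p ⟨hZ, h0⟩
  exact measure_mono_null hsub (measure_iUnion_null fun p => lebesgue_bisectorPart M M' p)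

end SPD

end Bisectors

/-! ### The center minimizes the expected squared distance -/

section PopulationRisk

namespace SPD

open Matrix

variable {d : ℕ}

lemma dist_sq_le_two_mul (x M Y : SPD d) :
    dist x Y ^ 2 ≤ 2 * d * (dist x M ^ 2 + dist M Y ^ 2) := by
  calc dist x Y ^ 2 ≤ (√d * (dist x M + dist M Y)) ^ 2 :=
        pow_le_pow_left₀ (dist_nonneg _ _) (dist_le_sqrt_mul_add _ _ _) 2
    _ = d * (dist x M + dist M Y) ^ 2 := by rw [mul_pow, Real.sq_sqrt (by positivity)]
    _ ≤ d * (2 * (dist x M ^ 2 + dist M Y ^ 2)) := by gcongr; exact add_sq_le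
    _ = _ := by ring

/-- The excess of the squared distance to `Y` over the squared distance to `M`. -/
noncomputable def excess (M Y x : SPD d) : ℝ := dist x Y ^ 2 - dist x M ^ 2

lemma continuous_excess (M Y : SPD d) : Continuous (excess M Y) :=
  ((continuous_dist_left Y).pow 2).sub ((continuous_dist_left M).pow 2)

lemma abs_excess_le (M Y x : SPD d) :
    |excess M Y x| ≤ 2 * d * (dist x M ^ 2 + dist M Y ^ 2) + dist x M ^ 2 := by
  refine (abs_sub _ _).trans (add_le_add ?_ ?_)
  · rw [abs_of_nonneg (sq_nonneg _)]; exact dist_sq_le_two_mul _ _ _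
  · rw [abs_of_nonneg (sq_nonneg _)]

lemma integrable_excess (M Y : SPD d) {σ : ℝ} (hσ : 0 < σ)
    [IsProbabilityMeasure (gaussian M σ)] : Integrable (excess M Y) (gaussian M σ) := by
  have h := integrable_dist_sq_gaussian M hσ
  refine Integrable.mono' (((h.add (integrable_const (dist M Y ^ 2))).const_mul (2 * d)).add h)
    (continuous_excess M Y).aestronglyMeasurable (ae_of_all _ fun x => ?_)
  exact abs_excess_le M Y x

/-- The integrand is the likelihood ratio of the Gaussians centered at `Y` and `M`, so the integral
is the mass of the former, which does not depend on the center. -/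
lemma lintegral_exp_neg_excess (M Y : SPD d) {σ : ℝ} [h : IsProbabilityMeasure (gaussian M σ)] :
    ∫⁻ x, ENNReal.ofReal (Real.exp (-(excess M Y x / (2 * σ ^ 2)))) ∂(gaussian M σ) = 1 := by
  have hY : gaussian Y σ Set.univ = 1 := by rw [gaussian_univ Y, ← gaussian_univ M, h.measure_univ]
  have hm : Measurable fun x => ENNReal.ofReal (Real.exp (-(excess M Y x / (2 * σ ^ 2)))) :=
    (Real.continuous_exp.comp ((continuous_excess M Y).div_const _).neg).measurable.ennreal_ofReal
  rw [← hY, gaussian, gaussian, withDensity_apply _ MeasurableSet.univ, setLIntegral_univ,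
    lintegral_withDensity_eq_lintegral_mul _ (measurable_ofReal_gaussianDensity M σ) hm]
  refine lintegral_congr fun x => ?_
  have hz : 0 ≤ 1 / zeta d σ := one_div_nonneg.2 (zeta_nonneg d σ)
  rw [Pi.mul_apply, gaussianDensity, gaussianDensity,
    ← ENNReal.ofReal_mul (mul_nonneg hz (Real.exp_pos _).le), mul_assoc, ← Real.exp_add, excess]
  congr 3
  ring

/-- The center of a Gaussian is the unique minimizer of the expected squared distance. -/
lemma integral_excess_pos {M Y : SPD d} (hY : Y ≠ M) {σ : ℝ} (hσ : 0 < σ)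
    [hprob : IsProbabilityMeasure (gaussian M σ)] : 0 < ∫ x, excess M Y x ∂(gaussian M σ) := by
  have hs : 0 < 2 * σ ^ 2 := by positivity
  set E : SPD d → ℝ := fun x => Real.exp (-(excess M Y x / (2 * σ ^ 2)))
  have hEc : Continuous E :=
    Real.continuous_exp.comp ((continuous_excess M Y).div_const _).neg
  have hE1 : ∫⁻ x, ENNReal.ofReal (E x) ∂(gaussian M σ) = 1 := lintegral_exp_neg_excess M Y
  have hEint : Integrable E (gaussian M σ) := by
    refine ⟨hEc.aestronglyMeasurable, ?_⟩
    rw [hasFiniteIntegral_iff_ofReal (ae_of_all _ fun x => (Real.exp_pos _).le), hE1]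
    exact ENNReal.one_lt_top
  have hE : ∫ x, E x ∂(gaussian M σ) = 1 := by
    rw [integral_eq_lintegral_of_nonneg_ae (ae_of_all _ fun x => (Real.exp_pos _).le)
      hEc.aestronglyMeasurable, hE1, ENNReal.toReal_one]
  have hr := integrable_excess M Y hσ
  set g : SPD d → ℝ := fun x => E x - 1 + excess M Y x / (2 * σ ^ 2)
  have hg0 : 0 ≤ g := fun x => by
    have := Real.add_one_le_exp (-(excess M Y x / (2 * σ ^ 2)))
    simp only [g, E, Pi.zero_apply]
    linarith
  have hgint : Integrable g (gaussian M σ) :=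
    (hEint.sub (integrable_const 1)).add (hr.div_const _)
  have hgI : ∫ x, g x ∂(gaussian M σ) = (∫ x, excess M Y x ∂(gaussian M σ)) / (2 * σ ^ 2) := by
    have h1 : Integrable (fun x => E x - 1) (gaussian M σ) := hEint.sub (integrable_const 1)
    simp only [g]
    rw [integral_add h1 (hr.div_const _),
      integral_sub hEint (integrable_const 1), hE, integral_div]
    simp
  have hpos : 0 < ∫ x, g x ∂(gaussian M σ) := by
    refine (integral_nonneg hg0).lt_of_ne fun h0 => ?_
    -- Equality in `1 - u ≤ exp (-u)` forces `u = 0`, so the bisector would have full measure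
    -- although it is null.
    have hae := (integral_eq_zero_iff_of_nonneg hg0 hgint).1 h0.symm
    have hnull : gaussian M σ {x | dist x Y = dist x M} = 0 :=
      withDensity_absolutelyContinuous _ _ (riemannianVolume_bisector hY)
    have hall : ∀ᵐ x ∂(gaussian M σ), x ∈ {x | dist x Y = dist x M} := by
      filter_upwards [hae] with x hx
      by_contra hne
      have hne' : -(excess M Y x / (2 * σ ^ 2)) ≠ 0 := by
        refine neg_ne_zero.2 (div_ne_zero (fun h => hne ?_) hs.ne')
        exact (sq_eq_sq₀ (dist_nonneg _ _) (dist_nonneg _ _)).1 (sub_eq_zero.1 h)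
      have := Real.add_one_lt_exp hne'
      simp only [g, E, Pi.zero_apply] at hx
      linarith
    have hfalse : ∀ᵐ x ∂(gaussian M σ), False := by
      filter_upwards [hall, measure_eq_zero_iff_ae_notMem.1 hnull] with x h1 h2 using h2 h1
    rw [ae_iff] at hfalse
    simp at hfalse
  rw [hgI] at hpos
  exact (div_pos_iff_of_pos_right hs).1 hpos

end SPD

end PopulationRisk

/-! ### Strong consistency of the Riemannian mean -/

section Consistency

namespace SPD

open Matrix

variable {d : ℕ}

lemma dist_self (P : SPD d) : dist P P = 0 := by
  refine le_antisymm ?_ (dist_nonneg _ _)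
  have h : Comparable 0 P P := fun v => by simp
  simpa using h.dist_le le_rfl

/-- Every nonempty sample has a Riemannian mean. -/
lemma exists_isRiemannianMean {N : ℕ} (hN : 0 < N) (x : Fin N → SPD d) :
    ∃ M, IsRiemannianMean x M := by
  have hc : Continuous fun Y => ∑ i, dist (x i) Y ^ 2 :=
    continuous_finsetSum _ fun i _ => (continuous_dist_right (x i)).pow 2
  set r := ∑ i, dist (x i) 1 ^ 2
  have hle : ∀ Y, dist (x ⟨0, hN⟩) Y ^ 2 ≤ ∑ i, dist (x i) Y ^ 2 := fun Y =>
    Finset.single_le_sum (f := fun i => dist (x i) Y ^ 2) (fun _ _ => sq_nonneg _)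
      (Finset.mem_univ _)
  -- Outside this compact ball the first summand alone exceeds `r`, the cost of the identity.
  have h1 : (1 : SPD d) ∈ {Y | dist (x ⟨0, hN⟩) Y ≤ √r} := Real.le_sqrt_of_sq_le (hle 1)
  obtain ⟨M, -, hM⟩ := (isCompact_dist_le (x ⟨0, hN⟩) (√r)).exists_isMinOn ⟨1, h1⟩ hc.continuousOn
  refine ⟨M, fun Y => ?_⟩
  by_cases hY : dist (x ⟨0, hN⟩) Y ≤ √r
  · exact hM hY
  · have h2 : r ≤ dist (x ⟨0, hN⟩) Y ^ 2 := (Real.lt_sq_of_sqrt_lt (not_le.1 hY)).le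
    exact (hM h1).trans (h2.trans (hle Y))

lemma isRiemannianMean_riemannianMean {N : ℕ} (hN : 0 < N) (x : Fin N → SPD d) :
    IsRiemannianMean x (riemannianMean x) :=
  Classical.epsilon_spec (exists_isRiemannianMean hN x)

variable {Ω : Type*} [MeasurableSpace Ω] {μ : Measure Ω}
  {α : Measure (SPD d)} {X : ℕ → Ω → SPD d}

/-- The strong law of large numbers for a function of a sample. -/
lemma ae_tendsto_average (hlaw : ∀ i, HasLaw (X i) α μ) (hindep : iIndepFun X μ)
    {f : SPD d → ℝ} (hf : Continuous f) (hint : Integrable f α) :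
    ∀ᵐ ω ∂μ, Tendsto (fun n : ℕ => (∑ i ∈ Finset.range n, f (X i ω)) / n) atTop
      (𝓝 (∫ x, f x ∂α)) := by
  have hI : ∫ x, f x ∂α = ∫ ω, f (X 0 ω) ∂μ :=
    ((hlaw 0).integral_comp hf.aestronglyMeasurable).symm
  rw [hI]
  refine strong_law_ae_real (fun i ω => f (X i ω)) ?_ (fun i j hij => ?_) fun i => ?_
  · rw [← (hlaw 0).map_eq] at hint
    exact hint.comp_aemeasurable (hlaw 0).aemeasurable
  · exact (hindep.indepFun hij).comp hf.measurable hf.measurable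
  · exact ((hlaw i).identDistrib (hlaw 0)).comp hf.measurable

lemma ae_eventually_sum_pos (hlaw : ∀ i, HasLaw (X i) α μ) (hindep : iIndepFun X μ)
    {f : SPD d → ℝ} (hf : Continuous f) (hint : Integrable f α) (hpos : 0 < ∫ x, f x ∂α) :
    ∀ᵐ ω ∂μ, ∀ᶠ n : ℕ in atTop, 0 < ∑ i ∈ Finset.range n, f (X i ω) := by
  filter_upwards [ae_tendsto_average hlaw hindep hf hint] with ω hω
  filter_upwards [hω.eventually_const_lt hpos, eventually_gt_atTop 0] with n hn hn0
  exact (div_pos_iff_of_pos_right (Nat.cast_pos.2 hn0)).1 hn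

/-- A shrinking sequence of compact neighborhoods of `Y`. -/
def compactNhd (Y : SPD d) (n : ℕ) : Set (SPD d) :=
  {Y' | Dist.dist Y'.coords Y.coords ≤ 1 / ((n : ℝ) + 1) ∧ dist Y Y' ≤ 1}

lemma self_mem_compactNhd (Y : SPD d) (n : ℕ) : Y ∈ compactNhd Y n := by
  refine ⟨?_, ?_⟩
  · rw [_root_.dist_self]; positivity
  · rw [dist_self]; exact zero_le_one

lemma isCompact_compactNhd (Y : SPD d) (n : ℕ) : IsCompact (compactNhd Y n) := by
  refine (isCompact_dist_le Y 1).of_isClosed_subset ?_ fun Y' h => h.2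
  exact (isClosed_le (continuous_coords.dist continuous_const) continuous_const).inter
    (isClosed_le (continuous_dist_right Y) continuous_const)

lemma compactNhd_mem_nhds (Y : SPD d) (n : ℕ) : compactNhd Y n ∈ 𝓝 Y := by
  have h1 : ∀ᶠ Y' in 𝓝 Y, Dist.dist Y'.coords Y.coords < 1 / ((n : ℝ) + 1) := by
    refine (continuous_coords.dist continuous_const).continuousAt.eventually_lt_const ?_
    beta_reduce
    rw [_root_.dist_self]; positivity
  have h2 : ∀ᶠ Y' in 𝓝 Y, dist Y Y' < 1 := by
    refine (continuous_dist_right Y).continuousAt.eventually_lt_const ?_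
    beta_reduce
    rw [dist_self]; exact one_pos
  filter_upwards [h1, h2] with Y' h1 h2 using ⟨h1.le, h2.le⟩

lemma tendsto_of_mem_compactNhd {Y : SPD d} {y : ℕ → SPD d} (h : ∀ n, y n ∈ compactNhd Y n) :
    Tendsto y atTop (𝓝 Y) := by
  rw [isEmbedding_coords.tendsto_nhds_iff, tendsto_iff_dist_tendsto_zero]
  exact squeeze_zero (fun _ => _root_.dist_nonneg) (fun n => (h n).1)
    tendsto_one_div_add_atTop_nhds_zero_nat

lemma continuous_excess_uncurry (M : SPD d) :
    Continuous (Function.uncurry fun x Y : SPD d => excess M Y x) :=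
  ((continuous_dist_comp continuous_fst continuous_snd).pow 2).sub
    ((continuous_dist_comp continuous_fst continuous_const).pow 2)

/-- Points other than the center, locally uniformly, eventually have a larger sum of squared
distances to the sample than the center. -/
lemma exists_nhds_ae_eventually_sum_excess_pos {M : SPD d} {σ : ℝ} (hσ : 0 < σ)
    [IsProbabilityMeasure (gaussian M σ)] (hlaw : ∀ i, HasLaw (X i) (gaussian M σ) μ)
    (hindep : iIndepFun X μ) {Y : SPD d} (hY : Y ≠ M) :
    ∃ U ∈ 𝓝 Y, ∀ᵐ ω ∂μ, ∀ᶠ n : ℕ in atTop, ∀ Y' ∈ U,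
      0 < ∑ i ∈ Finset.range n, excess M Y' (X i ω) := by
  -- The infimum bounds the excess of all nearby points at once, so one application of the strong
  -- law covers the neighborhood. Its expectation tends to that of the excess at `Y` by dominated
  -- convergence, hence is positive for some `n`.
  set g : ℕ → SPD d → ℝ := fun n x => sInf ((fun Y' => excess M Y' x) '' compactNhd Y n)
  have hcY : ∀ x, Continuous fun Y' => excess M Y' x := fun x =>
    ((continuous_dist_right x).pow 2).sub continuous_const
  have hattain : ∀ n x, ∃ y ∈ compactNhd Y n, g n x = excess M y x := fun n x =>
    (isCompact_compactNhd Y n).exists_sInf_image_eq ⟨Y, self_mem_compactNhd Y n⟩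
      (hcY x).continuousOn
  choose y hyK hyg using hattain
  have hgc : ∀ n, Continuous (g n) := fun n =>
    (isCompact_compactNhd Y n).continuous_sInf (continuous_excess_uncurry M)
  have hgle : ∀ n x, ∀ Y' ∈ compactNhd Y n, g n x ≤ excess M Y' x := fun n x Y' hY' =>
    csInf_le ((isCompact_compactNhd Y n).image (hcY x)).bddBelow (Set.mem_image_of_mem _ hY')
  set R : ℝ := 2 * d * (dist M Y ^ 2 + 1)
  have hR : ∀ Y' n, Y' ∈ compactNhd Y n → dist M Y' ^ 2 ≤ R := fun Y' n h => by
    have h1 := dist_sq_le_two_mul M Y Y'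
    have h2 : dist Y Y' ^ 2 ≤ 1 := pow_le_one₀ (dist_nonneg _ _) h.2
    refine h1.trans ?_
    simp only [R]
    gcongr
  set B : SPD d → ℝ := fun x => 2 * d * (dist x M ^ 2 + R) + dist x M ^ 2
  have hsq := integrable_dist_sq_gaussian M hσ
  have hB : Integrable B (gaussian M σ) :=
    ((hsq.add (integrable_const R)).const_mul (2 * d)).add hsq
  have hbound : ∀ n x, ‖g n x‖ ≤ B x := fun n x => by
    rw [hyg, Real.norm_eq_abs]
    refine (abs_excess_le M _ x).trans ?_
    have := hR _ n (hyK n x)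
    simp only [B]
    gcongr
  have hlim : Tendsto (fun n => ∫ x, g n x ∂(gaussian M σ)) atTop
      (𝓝 (∫ x, excess M Y x ∂(gaussian M σ))) := by
    refine tendsto_integral_of_dominated_convergence B (fun n => (hgc n).aestronglyMeasurable) hB
      (fun n => ae_of_all _ (hbound n)) (ae_of_all _ fun x => ?_)
    simp only [hyg]
    exact ((hcY x).tendsto Y).comp (tendsto_of_mem_compactNhd fun n => hyK n x)
  obtain ⟨n, hn⟩ := (hlim.eventually_const_lt (integral_excess_pos hY hσ)).exists
  have hgint : Integrable (g n) (gaussian M σ) :=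
    hB.mono' (hgc n).aestronglyMeasurable (ae_of_all _ (hbound n))
  refine ⟨compactNhd Y n, compactNhd_mem_nhds Y n, ?_⟩
  filter_upwards [ae_eventually_sum_pos hlaw hindep (hgc n) hgint hn] with ω hω
  filter_upwards [hω] with N hN Y' hY'
  exact hN.trans_le (Finset.sum_le_sum fun i _ => hgle n _ Y' hY')

/-- Far away points eventually have a larger sum of squared distances to the sample than the
center. -/
lemma exists_ae_eventually_sum_excess_pos {M : SPD d} {σ : ℝ} (hσ : 0 < σ)
    [IsProbabilityMeasure (gaussian M σ)] (hlaw : ∀ i, HasLaw (X i) (gaussian M σ) μ)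
    (hindep : iIndepFun X μ) :
    ∃ r : ℝ, ∀ᵐ ω ∂μ, ∀ᶠ n : ℕ in atTop, ∀ Y, r < dist M Y →
      0 < ∑ i ∈ Finset.range n, excess M Y (X i ω) := by
  set v := ∫ x, dist x M ^ 2 ∂(gaussian M σ)
  -- The weak triangle inequality gives `2d · excess ≥ δ(M,Y)² - 4d · δ(x,M)²`, and eventually the
  -- average of `δ(x,M)²` is below `v + 1`.
  refine ⟨√(4 * d * (v + 1)), ?_⟩
  filter_upwards [ae_tendsto_average hlaw hindep ((continuous_dist_left M).pow 2)
    (integrable_dist_sq_gaussian M hσ)] with ω hω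
  filter_upwards [hω.eventually_lt_const (lt_add_one v), eventually_gt_atTop 0] with n hn hn0 Y hY
  have hn0' : (0 : ℝ) < n := Nat.cast_pos.2 hn0
  have hY2 : 4 * d * (v + 1) < dist M Y ^ 2 := Real.lt_sq_of_sqrt_lt hY
  rw [div_lt_iff₀ hn0'] at hn
  have h1 : ∀ x, dist M Y ^ 2 - 4 * d * dist x M ^ 2 ≤ 2 * d * excess M Y x := fun x => by
    have := dist_sq_le_two_mul M x Y
    rw [dist_comm M x] at this
    rw [excess]
    linarith
  have h2 : n * dist M Y ^ 2 - 4 * d * ∑ i ∈ Finset.range n, dist (X i ω) M ^ 2 ≤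
      2 * d * ∑ i ∈ Finset.range n, excess M Y (X i ω) := by
    have := Finset.sum_le_sum fun i (_ : i ∈ Finset.range n) => h1 (X i ω)
    rwa [Finset.sum_sub_distrib, Finset.sum_const, Finset.card_range, nsmul_eq_mul,
      ← Finset.mul_sum, ← Finset.mul_sum] at this
  have h3 : 4 * d * ∑ i ∈ Finset.range n, dist (X i ω) M ^ 2 ≤ 4 * d * ((v + 1) * n) :=
    mul_le_mul_of_nonneg_left hn.le (by positivity)
  have h4 : n * (4 * d * (v + 1)) < n * dist M Y ^ 2 := mul_lt_mul_of_pos_left hY2 hn0'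
  have h5 : 0 < 2 * d * ∑ i ∈ Finset.range n, excess M Y (X i ω) := by linarith
  exact pos_of_mul_pos_right h5 (by positivity)

/-- Strong consistency of the Riemannian mean of a Gaussian sample. -/
lemma ae_tendsto_riemannianMean {M : SPD d} {σ : ℝ} (hσ : 0 < σ)
    [IsProbabilityMeasure (gaussian M σ)] (hlaw : ∀ i, HasLaw (X i) (gaussian M σ) μ)
    (hindep : iIndepFun X μ) :
    ∀ᵐ ω ∂μ, Tendsto (fun n : ℕ => riemannianMean fun i : Fin n => X i ω) atTop (𝓝 M) := by
  obtain ⟨r, hr⟩ := exists_ae_eventually_sum_excess_pos hσ hlaw hindep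
  have hnear : ∀ O : Set (SPD d), IsOpen O → M ∈ O → ∀ᵐ ω ∂μ, ∀ᶠ n : ℕ in atTop, ∀ Y ∉ O,
      0 < ∑ i ∈ Finset.range n, excess M Y (X i ω) := by
    intro O hO hMO
    have hne : ∀ Y ∈ {Y | dist M Y ≤ r} ∩ Oᶜ, Y ≠ M := fun Y hY h => hY.2 (h ▸ hMO)
    -- The exceptional null set depends on the point; a finite subcover of the compact remainder
    -- leaves finitely many of them.
    choose! U hU hUae using fun Y (hY : Y ≠ M) =>
      exists_nhds_ae_eventually_sum_excess_pos hσ hlaw hindep hY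
    obtain ⟨t, ht, htU⟩ := ((isCompact_dist_le M r).inter_right hO.isClosed_compl).elim_nhds_subcover
      U fun Y hY => hU Y (hne Y hY)
    have hall : ∀ᵐ ω ∂μ, ∀ Y ∈ t, ∀ᶠ n : ℕ in atTop, ∀ Y' ∈ U Y,
        0 < ∑ i ∈ Finset.range n, excess M Y' (X i ω) :=
      (ae_ball_iff t.countable_toSet).2 fun Y hY => hUae Y (hne Y (ht Y hY))
    filter_upwards [hr, hall] with ω h1 h2
    filter_upwards [h1, (eventually_all_finset t).2 h2] with n h3 h4 Y hY
    by_cases hYr : dist M Y ≤ r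
    · obtain ⟨Z, hZt, hZ⟩ := Set.mem_iUnion₂.1 (htU ⟨hYr, hY⟩)
      exact h4 Z hZt Y hZ
    · exact h3 Y (not_le.1 hYr)
  have : FirstCountableTopology (SPD d) :=
    isEmbedding_coords.isInducing.firstCountableTopology
  obtain ⟨O, hO, hbasis⟩ := (nhds_basis_opens M).exists_antitone_subbasis
  -- A countable neighborhood basis yields one null set for all neighborhoods of `M`.
  have hae := ae_all_iff.2 fun k => hnear (O k) (hO k).2 (hO k).1
  filter_upwards [hae] with ω hω
  refine hbasis.1.tendsto_right_iff.2 fun k _ => ?_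
  filter_upwards [hω k, eventually_gt_atTop 0] with n hn hn0
  by_contra hout
  have h1 := hn _ hout
  have h2 := isRiemannianMean_riemannianMean hn0 (fun i : Fin n => X i ω) M
  simp only [excess, Finset.sum_sub_distrib] at h1
  rw [Fin.sum_univ_eq_sum_range fun i => dist (X i ω) _ ^ 2,
    Fin.sum_univ_eq_sum_range fun i => dist (X i ω) _ ^ 2] at h2
  linarith

end SPD

end Consistency

/-! ### From convergence of means to agreement of classifiers -/

section Classifiers

namespace SPD

variable {d K : ℕ}

lemma ae_dist_ne {M M' : SPD d} (h : M ≠ M') :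
    ∀ᵐ Z ∂(riemannianVolume d), dist Z M ≠ dist Z M' := by
  rw [ae_iff]
  simpa only [ne_eq, not_not] using riemannianVolume_bisector h

lemma gaussianDensity_le_iff {σ : ℝ} (hσ : 0 < σ) (hz : 0 < zeta d σ) (M M' Z : SPD d) :
    gaussianDensity M σ Z ≤ gaussianDensity M' σ Z ↔ dist Z M' ≤ dist Z M := by
  rw [gaussianDensity, gaussianDensity, mul_le_mul_iff_of_pos_left (one_div_pos.2 hz),
    Real.exp_le_exp, div_le_div_iff_of_pos_right (by positivity), neg_le_neg_iff,
    sq_le_sq₀ (dist_nonneg _ _) (dist_nonneg _ _)]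

/-- If the class means converge to the centers, then eventually MDM classifiers assign `Z` to a
class whose center is nearest to `Z`. -/
lemma eventually_dist_le_of_isMDMClassifier {M : Fin K → SPD d} {x : Fin K → ℕ → SPD d}
    (hx : ∀ k, Tendsto (fun n : ℕ => riemannianMean fun i : Fin n => x k i) atTop (𝓝 (M k)))
    {c : (Fin K → ℕ) → SPD d → Fin K}
    (hc : ∀ N : Fin K → ℕ, IsMDMClassifier (fun k (i : Fin (N k)) => x k i) (c N)) (Z : SPD d) :
    ∀ᶠ N in atTop, ∀ l, dist Z (M (c N Z)) ≤ dist Z (M l) := by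
  -- In the pointwise order, `atTop` means that all training sizes are large simultaneously.
  have heval : ∀ k, Tendsto (fun N : Fin K → ℕ => N k) atTop atTop := fun k =>
    tendsto_atTop.2 fun b => (eventually_ge_atTop fun _ => b).mono fun N h => h k
  have hdist : ∀ k, Tendsto (fun N : Fin K → ℕ => dist Z (riemannianMean fun i : Fin (N k) => x k i))
      atTop (𝓝 (dist Z (M k))) := fun k =>
    ((continuous_dist_right Z).tendsto (M k)).comp ((hx k).comp (heval k))
  have hev : ∀ k l, ∀ᶠ N : Fin K → ℕ in atTop, dist Z (M l) < dist Z (M k) →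
      dist Z (riemannianMean fun i : Fin (N l) => x l i) <
        dist Z (riemannianMean fun i : Fin (N k) => x k i) := fun k l => by
    by_cases h : dist Z (M l) < dist Z (M k)
    · exact ((hdist l).eventually_lt (hdist k) h).mono fun N hN _ => hN
    · exact Eventually.of_forall fun N h' => absurd h' h
  filter_upwards [eventually_all.2 fun k => eventually_all.2 (hev k)] with N hN l
  by_contra! hlt
  exact (hN _ _ hlt).not_ge (hc N Z l)

end SPD

end Classifiers

theorem mainTheorem2 {d K : ℕ} (M : Fin K → SPD d) (σ : ℝ) (hσ : 0 < σ)
    {Ω : Type*} [MeasurableSpace Ω] (μ : Measure Ω) [IsProbabilityMeasure μ]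
    (X : Fin K → ℕ → Ω → SPD d)
    (hlaw : ∀ k i, HasLaw (X k i) (SPD.gaussian (M k) σ) μ)
    (hindep : ∀ k, iIndepFun (X k) μ) :
    ∀ᵐ ω ∂μ, ∀ c : (Fin K → ℕ) → SPD d → Fin K,
      (∀ N : Fin K → ℕ, SPD.IsMDMClassifier (fun k (i : Fin (N k)) => X k i ω) (c N)) →
      (∀ Z : SPD d, ∀ᶠ N in atTop,
        SPD.IsBayesClass (fun k => SPD.gaussianDensity (M k) σ) Z (c N Z)) ∧
      (Function.Injective M →
        ∀ b : SPD d → Fin K,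
          SPD.IsBayesClassifier (fun k => SPD.gaussianDensity (M k) σ) b →
          ∀ᵐ Z ∂(SPD.riemannianVolume d), ∀ᶠ N in atTop, c N Z = b Z) := by
  -- The total mass is not computed; it is one because the Gaussian is the law of a random matrix.
  have hprob : ∀ k, IsProbabilityMeasure (SPD.gaussian (M k) σ) := fun k => by
    rw [← (hlaw k 0).map_eq]
    exact Measure.isProbabilityMeasure_map (hlaw k 0).aemeasurable
  have hz : Fin K → 0 < SPD.zeta d σ := fun k => SPD.zeta_pos_of_isProbabilityMeasure (hprob k)
  have hmeans := ae_all_iff.2 fun k => SPD.ae_tendsto_riemannianMean hσ (hlaw k) (hindep k)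
  filter_upwards [hmeans] with ω hω c hc
  have hbayes : ∀ Z : SPD d, ∀ᶠ N in atTop,
      SPD.IsBayesClass (fun k => SPD.gaussianDensity (M k) σ) Z (c N Z) := fun Z => by
    filter_upwards [SPD.eventually_dist_le_of_isMDMClassifier (M := M)
      (x := fun k n => X k n ω) hω hc Z] with N hN l
    exact (SPD.gaussianDensity_le_iff hσ (hz l) _ _ _).2 (hN l)
  refine ⟨hbayes, fun hM b hb => ?_⟩
  have hne : ∀ᵐ Z ∂(SPD.riemannianVolume d), ∀ k l, k ≠ l →
      SPD.dist Z (M k) ≠ SPD.dist Z (M l) := by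
    refine ae_all_iff.2 fun k => ae_all_iff.2 fun l => ?_
    by_cases hkl : k = l
    · exact ae_of_all _ fun _ h => absurd hkl h
    · exact (SPD.ae_dist_ne (hM.ne hkl)).mono fun _ hZ _ => hZ
  filter_upwards [hne] with Z hZ
  filter_upwards [hbayes Z] with N hN
  by_contra hcb
  have h1 : SPD.gaussianDensity (M (b Z)) σ Z ≤ SPD.gaussianDensity (M (c N Z)) σ Z := hN (b Z)
  have h2 : SPD.gaussianDensity (M (c N Z)) σ Z ≤ SPD.gaussianDensity (M (b Z)) σ Z :=
    hb Z (c N Z)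
  rw [SPD.gaussianDensity_le_iff hσ (hz (b Z))] at h1 h2
  exact hZ _ _ hcb (le_antisymm h1 h2)
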